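/- **Setting.** Labels are $\pm1$. A *linear learning problem* consists of a marginal distribution $\mathcal D_{\mathcal X}$ on a space $\mathcal X$, a feature map $\phi:\mathcal X\to\mathbb R^d$, a set $\mathcal F=\{x\mapsto\langle\phi(x),w\rangle: w\in\mathcal W\}$ of linear regression functions with values in $[0,1]$, and a prior on $\mathcal F$ from which the true regression function $f^\star$ is drawn; given $f^\star$, examples $(x,y)$ are i.i.d. with $x\sim\mathcal D_{\mathcal X}$ and $\mathbb P(y=+1\mid x)=\eta(x)=f^\star(x)$. The standard excess error of a classifier $h$ is $\mathrm{err}(h)-\mathrm{err}(h^\star)$, where $\mathrm{err}(h)=\mathbb P(h(x)\ne y)$ and $h^\star=\mathrm{sgn}(2f^\star-1)$, $\mathrm{sgn}(0):=+1$. For a classifier that may abstain ($\bot$) it is the excess error of its randomized version, which predicts $\pm1$ with equal probability where the classifier abstains. *Noise-seeking Massart noise* with parameters $0\le\zeta_0<\tau_0\le\frac12$: $\mathbb P(\zeta_0<|\eta(x)-\frac12|\le\tau_0)=0$. *Noise-seeking Tsybakov noise* with parameters $0\le\zeta_0<\frac12$, $\beta\ge0$, $c>0$: $\mathbb P(\zeta_0<|\eta(x)-\frac12|\le\tau)\le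 c\,\tau^\beta$ for all $\tau>\zeta_0$. *Uncertainty-based learner* with labeling budget $B$: a (possibly randomized, measurable) active learner without abstention that sees unlabeled points $x_1,x_2,\dots$ one at a time and, before each point, has from its past observations an open interval $(\mathsf{lcb}(x),\mathsf{ucb}(x))$ for every $x\in\mathcal X$ that contains $\eta(x)$ (almost surely, for every $f^\star$ in the support of the prior); it queries the label of every observed point $x$ with $\frac12\in(\mathsf{lcb}(x),\mathsf{ucb}(x))$ until $B$ labels have been queried, and may or may not query other points. *Algorithm 1* with inputs $\epsilon,\delta,\gamma$ and hidden constants $C_1,C_2$. Let $\mathrm{Pdim}(\mathcal F)$ be the VC dimension of $\{(x,\zeta)\mapsto\mathbb 1(f(x)>\zeta):f\in\mathcal F\}$ and $\theta=\sup_{g\in\mathcal F,\,\iota>0}\theta_g(\mathcal F,\gamma/2,\iota)$, where $$\theta_g(\mathcal F,\gamma_0,\epsilon_0)=\Big(\sup_{\mathcal D}\sup_{\gamma'>\gamma_0,\,\epsilon'>\epsilon_0}\tfrac{\gamma'^2}{\epsilon'^2}\,\mathbb P_{x\sim\mathcal D}\big(\exists f\in\mathcal F:\ |f(x)-g(x)|>\gamma',\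 \|f-g\|_{L^2(\mathcal D)}\le\epsilon'\big)\Big)\vee 1,$$ the supremum being over all probability distributions $\mathcal D$ on $\mathcal X$. Put $T=\big\lceil C_1\frac{\theta\,\mathrm{Pdim}(\mathcal F)}{\epsilon\gamma}\log\frac{\theta\,\mathrm{Pdim}(\mathcal F)}{\epsilon\gamma\delta}\big\rceil$, $M=\lceil\log_2T\rceil$, $C_\delta=C_2\,\mathrm{Pdim}(\mathcal F)\log(T/\delta)$, $\tau_0=0$, $\tau_m=2^m$ for $m\ge1$, $\beta_m=(M-m+1)C_\delta$. In epoch $m=1,\dots,M$, with $Q_t\in\{0,1\}$ indicating whether the label of $x_t$ was queried, let $\hat R_m(f)=\sum_{t\le\tau_{m-1}}Q_t\,(f(x_t)-\mathbb 1(y_t=+1))^2$, let $\hat f_m$ be a minimizer of $\hat R_m$ over $\mathcal F$ (a regression oracle with any tie-breaking rule), $\mathcal F_m=\{f\in\mathcal F:\hat R_m(f)\le\hat R_m(\hat f_m)+\beta_m\}$, and let $\mathsf{lcb}_m(x)$ and $\mathsf{ucb}_m(x)$ be the infimum and the supremum of $f(x)$ over $f\in\mathcal F_m$. The classifier $\hat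 h_m(x)$ is $\bot$ if $[\mathsf{lcb}_m(x),\mathsf{ucb}_m(x)]\subseteq[\frac12-\gamma,\frac12+\gamma]$ and $\mathrm{sgn}(2\hat f_m(x)-1)$ otherwise. If $m=M$, return $\hat h_M$; otherwise, for $t=\tau_{m-1}+1,\dots,\tau_m$, observe $x_t$ and query its label iff $\frac12\in(\mathsf{lcb}_m(x_t),\mathsf{ucb}_m(x_t))$ and $\hat h_m(x_t)\ne\bot$. **Proposition.** There is a universal constant $c>0$ such that for every sufficiently large constant $C_2$, every constant $C_1$ that is sufficiently large given $C_2$, and some constant $C_3>0$ depending only on $C_1,C_2$, the following holds. Let $0<\epsilon\le1$, $0<\delta<1$, $0<\gamma<\frac12$, and let the labeling budget $B\in\mathbb N$ satisfy $$B\ \ge\ C_3\,\frac1{\gamma^2}\,\log^2\!\Big(\frac1{\epsilon\gamma}\Big)\,\log\!\Big(\frac1{\epsilon\gamma\delta}\Big).$$ Then there is a linear learning problem, with $\mathrm{Pdim}(\mathcal F)<\infty$ and $\theta<\infty$ and for which minimizers of the square loss over $\mathcal F$ exist for all finite samples, such that every $f^\star$ in the support of its prior satisfies the noise-seeking Massart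 condition for all $0\le\zeta_0<\tau_0<\frac12$ and the noise-seeking Tsybakov condition for all $0\le\zeta_0<\frac12$ and $\beta\ge0$ with $c_\beta=2^\beta$ as the constant, and such that: 1. every uncertainty-based learner with labeling budget $B$ has expected standard excess error at least $c/B$ (the expectation is over the draw of $f^\star$ from the prior, the data and the learner's randomness); 2. for every $f^\star$ in the support of the prior and every regression oracle, with probability at least $1-\delta$, Algorithm 1 queries at most $B$ labels and returns a classifier with standard excess error at most $\epsilon$. -/

import Mathlib

open MeasureTheory Set

namespace ActiveLearning

noncomputable section

/-! Labels are Booleans: `true` is the label `+1` and `false` is the label `-1`.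
A classifier that may abstain takes values in `Option Bool`; `none` is the abstention `⊥`. -/

/-- The numerical response used in the square loss: the indicator of the label `+1`, whose
conditional mean given `x` is `η x`. -/
def response (y : Bool) : ℝ := if y then 1 else 0

/-- The label `sgn (2 v - 1)` predicted from a regression value `v`, with `sgn 0 = +1`. -/
def signLabel (v : ℝ) : Bool := by
  classical exact decide (0 ≤ 2 * v - 1)

/-! ### Learning problems with linear regression functions -/

/-- A binary classification problem with linear regression functions.
The marginal law of `x` is `marginal`, the regression functions are `x ↦ ⟪feature x, w⟫` for
`w ∈ params`, all with values in `[0,1]`, and the true regression function `f⋆ = η` is one of them,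
drawn from `prior`. -/
structure LinearProblem (X : Type) [MeasurableSpace X] where
  marginal : Measure X
  marginal_prob : IsProbabilityMeasure marginal
  dim : ℕ
  feature : X → EuclideanSpace ℝ (Fin dim)
  measurable_feature : Measurable feature
  params : Set (EuclideanSpace ℝ (Fin dim))
  value_mem : ∀ w ∈ params, ∀ x, inner ℝ (feature x) w ∈ Icc (0 : ℝ) 1
  prior : PMF params

namespace LinearProblem

variable {X : Type} [MeasurableSpace X] (P : LinearProblem X)

/-- The regression function with parameter `w`. -/
def reg (w : P.params) (x : X) : ℝ := inner ℝ (P.feature x) (w : EuclideanSpace ℝ (Fin P.dim))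

/-- The set `F` of regression functions given to the learner. -/
def regressors : Set (X → ℝ) := range P.reg

/-- The joint law of `(x, y)` when `f⋆` has parameter `w`: `x` has the marginal law and
`y = +1` with conditional probability `η x = f⋆ x`. -/
def jointLaw (w : P.params) : Measure (X × Bool) :=
  (P.marginal.withDensity (fun x => ENNReal.ofReal (P.reg w x))).map (fun x => (x, true)) +
  (P.marginal.withDensity (fun x => ENNReal.ofReal (1 - P.reg w x))).map (fun x => (x, false))

theorem measurable_reg (w : P.params) : Measurable (P.reg w) := by
  unfold reg
  exact P.measurable_feature.inner measurable_const

instance isProbabilityMeasure_jointLaw (w : P.params) :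
    IsProbabilityMeasure (P.jointLaw w) := by
  constructor
  have := P.marginal_prob
  have hm := P.measurable_reg w
  have h1 : Measurable (fun x : X => (x, true)) := by fun_prop
  have h2 : Measurable (fun x : X => (x, false)) := by fun_prop
  rw [jointLaw, Measure.add_apply, Measure.map_apply h1 MeasurableSet.univ,
    Measure.map_apply h2 MeasurableSet.univ, preimage_univ, preimage_univ,
    withDensity_apply _ MeasurableSet.univ, withDensity_apply _ MeasurableSet.univ,
    Measure.restrict_univ, ← lintegral_add_left (by fun_prop)]
  have : ∀ x, ENNReal.ofReal (P.reg w x) + ENNReal.ofReal (1 - P.reg w x) = 1 := by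
    intro x
    have h := P.value_mem w w.2 x
    have h' : P.reg w x ∈ Icc (0 : ℝ) 1 := h
    rw [← ENNReal.ofReal_add h'.1 (by linarith [h'.2])]
    simp
  simp [this]

/-- The law of an infinite i.i.d. sequence of labelled examples (labels are hidden from a learner
until it queries them). -/
def dataLaw (w : P.params) : Measure (ℕ → X × Bool) :=
  Measure.infinitePi (fun _ : ℕ => P.jointLaw w)

/-- The error `ℙ (h x ≠ y)`. -/
def err (w : P.params) (h : X → Bool) : ℝ := (P.jointLaw w).real {z | h z.1 ≠ z.2}

/-- The Bayes classifier `sgn (2 f⋆ - 1)`. -/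
def bayes (w : P.params) (x : X) : Bool := signLabel (P.reg w x)

/-- The standard excess error of a classifier. -/
def excess (w : P.params) (h : X → Bool) : ℝ := P.err w h - P.err w (P.bayes w)

/-- The error of the randomized version of an abstaining classifier: on the abstention region it
predicts `+1` or `-1` according to an independent fair coin. -/
def randomizedErr (w : P.params) (h : X → Option Bool) : ℝ :=
  (P.err w (fun x => (h x).getD true) + P.err w (fun x => (h x).getD false)) / 2

/-- The standard excess error of the randomized version of an abstaining classifier. -/
def randomizedExcess (w : P.params) (h : X → Option Bool) : ℝ :=
  P.randomizedErr w h - P.err w (P.bayes w)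

/-- Noise-seeking Massart noise with parameters `0 ≤ ζ < τ ≤ 1/2` when `f⋆` has parameter `w`. -/
def NoiseSeekingMassart (w : P.params) (ζ τ : ℝ) : Prop :=
  0 ≤ ζ ∧ ζ < τ ∧ τ ≤ 1 / 2 ∧
    P.marginal {x | ζ < |P.reg w x - 1 / 2| ∧ |P.reg w x - 1 / 2| ≤ τ} = 0

/-- Noise-seeking Tsybakov noise with parameters `0 ≤ ζ < 1/2`, `0 ≤ β` and constant `0 < c`
when `f⋆` has parameter `w`. -/
def NoiseSeekingTsybakov (w : P.params) (ζ β c : ℝ) : Prop :=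
  0 ≤ ζ ∧ ζ < 1 / 2 ∧ 0 ≤ β ∧ 0 < c ∧ ∀ τ, ζ < τ →
    P.marginal {x | ζ < |P.reg w x - 1 / 2| ∧ |P.reg w x - 1 / 2| ≤ τ} ≤
      ENNReal.ofReal (c * τ ^ β)

end LinearProblem

/-! ### Active learners with a label budget -/

/-- What a learner sees of a label. -/
inductive Feedback where
  | hidden
  | revealed (y : Bool)

instance : MeasurableSpace Feedback := ⊤

/-- A (randomized) active learner without abstention. After `t` rounds, it has a confidence
interval at each point and decides whether to query the label of the next point. Everything depends
on its random seed and on what it has observed so far. Its final classifier may depend on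
everything that is ever observed, so rules that stop early are included. -/
structure ActiveLearner (X : Type) [MeasurableSpace X] where
  Seed : Type
  seedSpace : MeasurableSpace Seed
  seedLaw : Measure Seed
  seedLaw_prob : IsProbabilityMeasure seedLaw
  lcb : (t : ℕ) → Seed → (Fin t → X × Feedback) → X → ℝ
  ucb : (t : ℕ) → Seed → (Fin t → X × Feedback) → X → ℝ
  asks : (t : ℕ) → Seed → (Fin t → X × Feedback) → X → Bool
  output : Seed → (ℕ → X × Feedback) → X → Bool
  measurable_asks : ∀ t, Measurable
    (fun p : Seed × (Fin t → X × Feedback) × X => asks t p.1 p.2.1 p.2.2)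
  measurable_output : Measurable
    (fun p : Seed × (ℕ → X × Feedback) × X => output p.1 p.2.1 p.2.2)

attribute [instance] ActiveLearner.seedSpace ActiveLearner.seedLaw_prob

namespace ActiveLearner

variable {X : Type} [MeasurableSpace X] (L : ActiveLearner X)

open Classical in
/-- The observations of the first `t` rounds with label budget `B`: a label is revealed iff the
learner asks for it and fewer than `B` labels have been revealed before. -/
def history (B : ℕ) (s : L.Seed) (z : ℕ → X × Bool) : (t : ℕ) → Fin t → X × Feedback
  | 0 => Fin.elim0
  | t + 1 =>
    Fin.snoc (α := fun _ => X × Feedback) (history B s z t)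
      ((z t).1,
        if L.asks t s (history B s z t) (z t).1 = true ∧
            Nat.card {i : Fin t // (history B s z t i).2 ≠ Feedback.hidden} < B
        then Feedback.revealed (z t).2 else Feedback.hidden)

/-- The whole sequence of observations. -/
def observed (B : ℕ) (s : L.Seed) (z : ℕ → X × Bool) (t : ℕ) : X × Feedback :=
  L.history B s z (t + 1) (Fin.last t)

/-- The learner is uncertainty-based for the problem `P` with label budget `B`: its open confidence
intervals contain `η x`, whichever of the possible regression functions is the true one (almost
surely over the run), and it asks for the label of each point whose interval contains `1/2`. -/
def UncertaintyBased (P : LinearProblem X) (B : ℕ) : Prop :=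
  (∀ w ∈ P.prior.support, ∀ᵐ p ∂(L.seedLaw.prod (P.dataLaw w)), ∀ t x,
    P.reg w x ∈ Ioo (L.lcb t p.1 (L.history B p.1 p.2 t) x)
      (L.ucb t p.1 (L.history B p.1 p.2 t) x)) ∧
  (∀ t s o x, (1 / 2 : ℝ) ∈ Ioo (L.lcb t s o x) (L.ucb t s o x) → L.asks t s o x = true)

/-- The expected standard excess error, over the draw of `f⋆`, the data and the seed. -/
def expectedExcess (P : LinearProblem X) (B : ℕ) : ℝ :=
  ∑' w : P.params, (P.prior w).toReal *
    ∫ p, P.excess w (L.output p.1 (L.observed B p.1 p.2)) ∂(L.seedLaw.prod (P.dataLaw w))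

end ActiveLearner

/-! ### Complexity measures -/

section Complexity

variable {X : Type}

/-- Shattering of a finite set by the threshold functions `(x, ζ) ↦ 1 (f x > ζ)`, `f ∈ F`. -/
def PseudoShatters (F : Set (X → ℝ)) (s : Finset (X × ℝ)) : Prop :=
  ∀ t ⊆ s, ∃ f ∈ F, ∀ p ∈ s, p.2 < f p.1 ↔ p ∈ t

/-- The pseudo-dimension: the VC dimension of the threshold functions. -/
def pseudoDim (F : Set (X → ℝ)) : ℕ∞ :=
  ⨆ (s : Finset (X × ℝ)) (_ : PseudoShatters F s), (s.card : ℕ∞)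

variable [MeasurableSpace X]

/-- The value function disagreement coefficient of `F` at `g`. -/
def disagreementCoeff (F : Set (X → ℝ)) (g : X → ℝ) (γ₀ ε₀ : ℝ) : ENNReal :=
  (⨆ (μ : ProbabilityMeasure X) (γ : ℝ) (ε : ℝ) (_ : γ₀ < γ) (_ : ε₀ < ε),
    ENNReal.ofReal (γ ^ 2 / ε ^ 2) *
      (μ : Measure X) {x | ∃ f ∈ F, γ < |f x - g x| ∧
        Real.sqrt (∫ u, (f u - g u) ^ 2 ∂(μ : Measure X)) ≤ ε}) ⊔ 1

/-- The supremum `θ` of the disagreement coefficients at level `γ / 2` over `F` and all `ι > 0`. -/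
def disagreementSup (F : Set (X → ℝ)) (γ : ℝ) : ENNReal :=
  ⨆ (g : X → ℝ) (_ : g ∈ F) (ι : ℝ) (_ : 0 < ι), disagreementCoeff F g (γ / 2) ι

end Complexity

/-! ### The epoch-based algorithm with abstention -/

namespace EpochAlgorithm

section Epoch

variable {X : Type}

/-- The cumulative square loss over a list of queried examples. -/
def loss (f : X → ℝ) (S : List (X × Bool)) : ℝ :=
  (S.map (fun z => (f z.1 - response z.2) ^ 2)).sum

/-- A regression oracle: it returns a minimizer over `F` of the square loss (with any rule for
ties). -/
def IsRegressionOracle (F : Set (X → ℝ)) (oracle : List (X × Bool) → X → ℝ) : Prop :=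
  ∀ S, oracle S ∈ F ∧ ∀ f ∈ F, loss (oracle S) S ≤ loss f S

variable (F : Set (X → ℝ)) (oracle : List (X × Bool) → X → ℝ) (γ : ℝ)

/-- The active set of regression functions, with threshold `b`. -/
def activeSet (b : ℝ) (S : List (X × Bool)) : Set (X → ℝ) :=
  {f | f ∈ F ∧ loss f S ≤ loss (oracle S) S + b}

def lcb (A : Set (X → ℝ)) (x : X) : ℝ := sInf ((fun f => f x) '' A)

def ucb (A : Set (X → ℝ)) (x : X) : ℝ := sSup ((fun f => f x) '' A)

open Classical in
/-- The abstaining classifier built from the queried examples `S`. -/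
def classifier (b : ℝ) (S : List (X × Bool)) (x : X) : Option Bool :=
  if Icc (lcb (activeSet F oracle b S) x) (ucb (activeSet F oracle b S) x) ⊆
      Icc (1 / 2 - γ) (1 / 2 + γ)
  then none
  else some (signLabel (oracle S x))

/-- The query rule built from the queried examples `S`. -/
def Queries (b : ℝ) (S : List (X × Bool)) (x : X) : Prop :=
  (1 / 2 : ℝ) ∈ Ioo (lcb (activeSet F oracle b S) x) (ucb (activeSet F oracle b S) x) ∧
    classifier F oracle γ b S x ≠ none

/-- The end `τ_m` of epoch `m`. -/
def epochEnd (m : ℕ) : ℕ := if m = 0 then 0 else 2 ^ m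

open Classical in
/-- The queried examples (in order) after the first `m` epochs, with threshold `β k` in epoch `k`.
The example of time `t = 1, 2, …` is `z (t - 1)`. -/
def queried (β : ℕ → ℝ) (z : ℕ → X × Bool) : ℕ → List (X × Bool)
  | 0 => []
  | m + 1 => queried β z m ++
      ((List.range' (epochEnd m) (epochEnd (m + 1) - epochEnd m)).filter
        (fun i => decide (Queries F oracle γ (β (m + 1)) (queried β z m) (z i).1))).map z

variable [MeasurableSpace X]

/-- The sample size `T`, with hidden constant `C₁`. -/
def sampleSize (C₁ ε δ : ℝ) : ℕ :=
  ⌈C₁ * ((disagreementSup F γ).toReal * ((pseudoDim F).toNat : ℝ) / (ε * γ)) *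
    Real.log ((disagreementSup F γ).toReal * ((pseudoDim F).toNat : ℝ) / (ε * γ * δ))⌉₊

/-- The number of epochs `M = ⌈log₂ T⌉`. -/
def epochs (C₁ ε δ : ℝ) : ℕ := Nat.clog 2 (sampleSize F γ C₁ ε δ)

/-- The threshold `β_m = (M - m + 1) C_δ` with `C_δ = C₂ Pdim(F) log (T / δ)`. -/
def threshold (C₁ C₂ ε δ : ℝ) (m : ℕ) : ℝ :=
  ((epochs F γ C₁ ε δ : ℝ) - m + 1) *
    (C₂ * ((pseudoDim F).toNat : ℝ) * Real.log ((sampleSize F γ C₁ ε δ : ℝ) / δ))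

/-- The labelled examples available at the start of the last epoch `M`, when the algorithm
returns. -/
def finalSample (C₁ C₂ ε δ : ℝ) (z : ℕ → X × Bool) : List (X × Bool) :=
  queried F oracle γ (threshold F γ C₁ C₂ ε δ) z (epochs F γ C₁ ε δ - 1)

/-- The classifier returned by the algorithm. -/
def returned (C₁ C₂ ε δ : ℝ) (z : ℕ → X × Bool) : X → Option Bool :=
  classifier F oracle γ (threshold F γ C₁ C₂ ε δ (epochs F γ C₁ ε δ))
    (finalSample F oracle γ C₁ C₂ ε δ z)

/-- The number of labels queried by the algorithm. -/
def labelCount (C₁ C₂ ε δ : ℝ) (z : ℕ → X × Bool) : ℕ :=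
  (finalSample F oracle γ C₁ C₂ ε δ z).length

end Epoch

end EpochAlgorithm

end

end ActiveLearning

open MeasureTheory Set

namespace ActiveLearning

/-! ### The two-point problem

The point `false` is pure noise (`η = 1/2`, whatever the parameter) and carries almost all the
mass; the point `true` has mass `p` and is noiseless under the prior. -/

/-! The problem lives on two points. At `false`, of mass `1 - p`, every regression function equals
`1/2`; at `true`, of mass `p = 1 / (2 * B)`, the value is free in `[0,1]` for the class but is `0`
or `1`, each with probability `1/2`, under the prior. Only the prediction at `true` affects the
excess error.

Lower bound. A valid open interval at `false` always contains `1/2`, so an uncertainty-based learner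
must query this useless point. With probability `(1 - p) ^ B ≥ 1/2` the first `B` examples are all
`false` and exhaust the budget, so no label of `true` is ever seen. Reversing those labels exchanges
the two hypotheses but leaves the observations unchanged (`observed_flipLabel`), so one output
serves both and is wrong for one of them. The average excess is at least `p * (1 - p) ^ B / 2 ≥ 1 /
(8 * B)` (`expectedExcess_lower_bound`).

Upper bound. The bounds of Algorithm 1 never straddle `1/2` at `false`, where the class has a single
value, so only `true` is queried (`not_queries_false`). Its labels are noiseless: the true function
has zero loss and is never eliminated, one label makes every square-loss minimizer correct at
`true`, and `n` labels stop the querying once `n > 4 * β_m`. Randomness enters almost surely only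
through the number of visits to `true`, a binomial variable. At a time `2 ^ j` of order `B ^ 2` it
lies, with high probability, below `B` and above four times every threshold, unless the run ends
earlier; this bounds the label count (`length_queried_le`). For the error, either `p ≤ ε` and
nothing is needed, or `ε < p` and `true` is visited before the last epoch with high probability. -/

/-- The parameters of the two-point problem: the segment `{1/2} × [0,1]`. -/
def twoPointParams : Set (EuclideanSpace ℝ (Fin 2)) := {w | w 0 = 1 / 2 ∧ w 1 ∈ Icc (0 : ℝ) 1}

/-- The parameter `(1/2, b)`. -/
noncomputable def segmentParam (b : Icc (0 : ℝ) 1) : twoPointParams :=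
  ⟨!₂[1 / 2, (b : ℝ)], by simp [twoPointParams, b.2.1, b.2.2]⟩

theorem segmentParam_one_ne_zero : segmentParam 1 ≠ segmentParam 0 := by
  intro h
  have h1 := congrArg (fun w : twoPointParams => w.1 1) h
  simp [segmentParam] at h1

/-- The feature map of the two-point problem. -/
noncomputable def twoPointFeature (x : Bool) : EuclideanSpace ℝ (Fin 2) :=
  EuclideanSpace.single (if x then 1 else 0) 1

theorem inner_twoPointFeature (x : Bool) (w : EuclideanSpace ℝ (Fin 2)) :
    inner ℝ (twoPointFeature x) w = w (if x then 1 else 0) := by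
  simp [twoPointFeature, EuclideanSpace.inner_single_left]

open Classical in
/-- The two-point problem in which the learnable point has mass `p`. -/
noncomputable def twoPointProblem (p : Icc (0 : ℝ) 1) : LinearProblem Bool where
  marginal := ENNReal.ofReal (1 - p) • Measure.dirac false + ENNReal.ofReal p • Measure.dirac true
  marginal_prob := by
    constructor
    simp only [Measure.coe_add, Measure.coe_smul, Pi.add_apply, Pi.smul_apply, measure_univ,
      smul_eq_mul, mul_one]
    rw [← ENNReal.ofReal_add (by linarith [p.2.2]) p.2.1]
    simp
  dim := 2
  feature := twoPointFeature
  measurable_feature := measurable_from_top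
  params := twoPointParams
  value_mem := by
    intro w hw x
    rw [inner_twoPointFeature]
    cases x
    · simp only [Bool.false_eq_true, if_false, hw.1]
      norm_num
    · simpa using hw.2
  prior := PMF.uniformOfFinset {segmentParam 1, segmentParam 0} (by simp)

instance isProbabilityMeasure_dataLaw {X : Type} [MeasurableSpace X] (P : LinearProblem X)
    (w : P.params) : IsProbabilityMeasure (P.dataLaw w) := by
  unfold LinearProblem.dataLaw
  infer_instance

/-! ### Laws, errors and excess errors on two points. -/

section Basic

variable (p : Icc (0 : ℝ) 1)

/-- The parameter of the regression function with value `b` at `true`. -/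
noncomputable def pointParam (b : Icc (0 : ℝ) 1) : (twoPointProblem p).params := segmentParam b

/-- The parameter of the regression function for which `true` has the label `y`. -/
noncomputable def labelParam (y : Bool) : (twoPointProblem p).params :=
  pointParam p (if y then 1 else 0)

theorem reg_twoPoint_false (w : (twoPointProblem p).params) :
    (twoPointProblem p).reg w false = 1 / 2 :=
  (inner_twoPointFeature false w.1).trans w.2.1

theorem reg_pointParam_true (b : Icc (0 : ℝ) 1) :
    (twoPointProblem p).reg (pointParam p b) true = b := by
  refine (inner_twoPointFeature true (segmentParam b).1).trans ?_
  simp [segmentParam]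

theorem reg_labelParam_true (y : Bool) :
    (twoPointProblem p).reg (labelParam p y) true = response y := by
  rw [labelParam, reg_pointParam_true]
  cases y <;> simp [response]

theorem support_prior :
    (twoPointProblem p).prior.support = {labelParam p true, labelParam p false} := by
  classical
  refine (PMF.support_uniformOfFinset
    (s := ({segmentParam 1, segmentParam 0} : Finset twoPointParams)) (by simp)).trans ?_
  rw [Finset.coe_pair]
  rfl

theorem mem_support_prior {w : (twoPointProblem p).params}
    (hw : w ∈ (twoPointProblem p).prior.support) : ∃ y, w = labelParam p y := by
  rw [support_prior] at hw
  exact hw.elim (fun h => ⟨true, h⟩) (fun h => ⟨false, h⟩)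

theorem labelParam_mem_support (y : Bool) :
    labelParam p y ∈ (twoPointProblem p).prior.support := by
  rw [support_prior]
  cases y <;> simp

theorem prior_labelParam (y : Bool) : (twoPointProblem p).prior (labelParam p y) = 2⁻¹ := by
  classical
  refine (PMF.uniformOfFinset_apply_of_mem
    (s := ({segmentParam 1, segmentParam 0} : Finset twoPointParams)) (by simp)
    (a := segmentParam (if y then 1 else 0)) (by cases y <;> simp)).trans ?_
  rw [Finset.card_pair segmentParam_one_ne_zero]
  rfl

theorem tsum_prior_mul (g : (twoPointProblem p).params → ℝ) :
    ∑' w, ((twoPointProblem p).prior w).toReal * g w =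
      (g (labelParam p true) + g (labelParam p false)) / 2 := by
  classical
  have hne : labelParam p true ≠ labelParam p false := segmentParam_one_ne_zero
  rw [tsum_eq_sum (s := ({labelParam p true, labelParam p false} : Finset _))]
  · rw [Finset.sum_pair hne, prior_labelParam, prior_labelParam]
    simp only [ENNReal.toReal_inv, ENNReal.toReal_ofNat]
    ring
  · intro w hw
    have : (twoPointProblem p).prior w = 0 := by
      rw [PMF.apply_eq_zero_iff, support_prior]
      simpa using hw
    simp [this]

theorem marginal_twoPoint_singleton (x : Bool) :
    (twoPointProblem p).marginal {x} = ENNReal.ofReal (if x then (p : ℝ) else 1 - p) := by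
  change (ENNReal.ofReal (1 - p) • Measure.dirac false +
    ENNReal.ofReal p • Measure.dirac true : Measure Bool) {x} = _
  cases x <;> simp

theorem jointLaw_singleton {X : Type} [MeasurableSpace X] [MeasurableSingletonClass X]
    (P : LinearProblem X) (w : P.params) (x : X) (y : Bool) :
    P.jointLaw w {(x, y)} =
      P.marginal {x} * ENNReal.ofReal (if y then P.reg w x else 1 - P.reg w x) := by
  have h1 : Measurable (fun x : X => (x, true)) := by fun_prop
  have h2 : Measurable (fun x : X => (x, false)) := by fun_prop
  have hs := measurableSet_singleton (x, y)
  rw [LinearProblem.jointLaw, Measure.add_apply, Measure.map_apply h1 hs,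
    Measure.map_apply h2 hs, withDensity_apply _ (h1 hs), withDensity_apply _ (h2 hs)]
  have e : ∀ b : Bool, (fun x : X => (x, b)) ⁻¹' {(x, y)} = if b = y then {x} else ∅ := by
    intro b
    ext u
    by_cases hb : b = y <;> simp [hb]
  rw [e, e]
  cases y <;> simp [mul_comm]

theorem jointLaw_real_false (w : (twoPointProblem p).params) (y : Bool) :
    ((twoPointProblem p).jointLaw w).real {(false, y)} = (1 - p) / 2 := by
  have := p.2.2
  rw [Measure.real, jointLaw_singleton, marginal_twoPoint_singleton, reg_twoPoint_false,
    ENNReal.toReal_mul]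
  have h2 : (2 : ℝ)⁻¹ = 1 - 2⁻¹ := by norm_num
  cases y
  · simp [div_eq_mul_inv, ← h2, this]
  · simp [div_eq_mul_inv, this]

theorem jointLaw_real_true (y' y : Bool) :
    ((twoPointProblem p).jointLaw (labelParam p y')).real {(true, y)} =
      if y = y' then (p : ℝ) else 0 := by
  have := p.2.1
  rw [Measure.real, jointLaw_singleton, marginal_twoPoint_singleton, reg_labelParam_true,
    ENNReal.toReal_mul]
  cases y <;> cases y' <;> simp [response, this]

/-- Any prediction at the noise point errs with conditional probability `1/2`, so the choice made
there does not matter. -/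
theorem err_twoPoint (y : Bool) (h : Bool → Bool) :
    (twoPointProblem p).err (labelParam p y) h =
      (1 - p) / 2 + if h true = y then 0 else (p : ℝ) := by
  have hset : {z : Bool × Bool | h z.1 ≠ z.2} = {(false, !(h false))} ∪ {(true, !(h true))} := by
    ext ⟨x, b⟩
    cases x <;> cases b <;> simp
  rw [LinearProblem.err, hset, measureReal_union (by simp) (measurableSet_singleton _),
    jointLaw_real_false, jointLaw_real_true]
  cases h true <;> cases y <;> simp

theorem bayes_twoPoint_true (y : Bool) : (twoPointProblem p).bayes (labelParam p y) true = y := by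
  rw [LinearProblem.bayes, reg_labelParam_true]
  cases y
  · simp [signLabel, response]
  · simp [signLabel, response]

theorem excess_twoPoint (y : Bool) (h : Bool → Bool) :
    (twoPointProblem p).excess (labelParam p y) h = if h true = y then 0 else (p : ℝ) := by
  rw [LinearProblem.excess, err_twoPoint, err_twoPoint, bayes_twoPoint_true]
  simp

theorem randomizedExcess_twoPoint_le (y : Bool) (h : Bool → Option Bool) :
    (twoPointProblem p).randomizedExcess (labelParam p y) h ≤ p := by
  have := p.2.1
  rw [LinearProblem.randomizedExcess, LinearProblem.randomizedErr, err_twoPoint, err_twoPoint,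
    err_twoPoint, bayes_twoPoint_true]
  split_ifs <;> linarith

theorem randomizedExcess_twoPoint_of_eq {y : Bool} {h : Bool → Option Bool}
    (hy : h true = some y) : (twoPointProblem p).randomizedExcess (labelParam p y) h = 0 := by
  rw [LinearProblem.randomizedExcess, LinearProblem.randomizedErr, err_twoPoint, err_twoPoint,
    err_twoPoint, bayes_twoPoint_true]
  simp [hy]

/-! ### Noise conditions -/

theorem noiseSet_twoPoint_eq_empty (y : Bool) {ζ τ : ℝ} (hζ : 0 ≤ ζ) (hτ : τ < 1 / 2) :
    {x | ζ < |(twoPointProblem p).reg (labelParam p y) x - 1 / 2| ∧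
      |(twoPointProblem p).reg (labelParam p y) x - 1 / 2| ≤ τ} = ∅ := by
  ext x
  simp only [mem_ofPred_eq, mem_empty_iff_false, iff_false, not_and, not_le]
  intro hx
  cases x
  · rw [reg_twoPoint_false] at hx
    simp only [sub_self, abs_zero] at hx
    linarith
  · rw [reg_labelParam_true]
    have : |response y - 1 / 2| = 1 / 2 := by
      cases y
      · norm_num [response, abs_of_neg]
      · norm_num [response, abs_of_pos]
    rwa [this]

theorem massart_twoPoint (y : Bool) {ζ τ : ℝ} (hζ : 0 ≤ ζ) (h : ζ < τ) (hτ : τ < 1 / 2) :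
    (twoPointProblem p).NoiseSeekingMassart (labelParam p y) ζ τ := by
  refine ⟨hζ, h, hτ.le, ?_⟩
  rw [noiseSet_twoPoint_eq_empty p y hζ hτ, measure_empty]

/-- The margin `|η - 1/2|` takes only the values `0` and `1/2`. For `τ < 1/2` the event is empty,
and for `τ ≥ 1/2` the bound `(2 * τ) ^ β` is at least `1`. -/
theorem tsybakov_twoPoint (y : Bool) {ζ β : ℝ} (hζ : 0 ≤ ζ) (h : ζ < 1 / 2) (hβ : 0 ≤ β) :
    (twoPointProblem p).NoiseSeekingTsybakov (labelParam p y) ζ β ((2 : ℝ) ^ β) := by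
  refine ⟨hζ, h, hβ, by positivity, fun τ hτ => ?_⟩
  by_cases hτ' : τ < 1 / 2
  · rw [noiseSet_twoPoint_eq_empty p y hζ hτ', measure_empty]
    exact zero_le
  · push Not at hτ'
    have := (twoPointProblem p).marginal_prob
    refine prob_le_one.trans ?_
    rw [← Real.mul_rpow zero_le_two (by linarith)]
    exact ENNReal.one_le_ofReal.2 (Real.one_le_rpow (by linarith) hβ)

/-! ### Complexity measures -/

theorem mem_regressors_false {f : Bool → ℝ} (hf : f ∈ (twoPointProblem p).regressors) :
    f false = 1 / 2 := by
  obtain ⟨w, rfl⟩ := hf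
  exact reg_twoPoint_false p w

theorem mem_regressors_true {f : Bool → ℝ} (hf : f ∈ (twoPointProblem p).regressors) :
    f true ∈ Icc (0 : ℝ) 1 := by
  obtain ⟨w, rfl⟩ := hf
  exact (twoPointProblem p).value_mem w w.2 true

theorem exists_mem_regressors {b : ℝ} (hb : b ∈ Icc (0 : ℝ) 1) :
    ∃ f ∈ (twoPointProblem p).regressors, f true = b :=
  ⟨_, ⟨pointParam p ⟨b, hb⟩, rfl⟩, reg_pointParam_true p _⟩

/-- Points over `false` cannot be shattered because all functions agree there, and over `true` the
threshold sets are nested, so two distinct levels cannot be separated both ways. -/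
theorem pseudoDim_twoPoint : pseudoDim (twoPointProblem p).regressors = 1 := by
  apply le_antisymm
  · refine iSup₂_le fun s hs => ?_
    have htrue : ∀ q ∈ s, q.1 = true := by
      intro q hq
      by_contra hne
      have hfalse : q.1 = false := by simpa using hne
      obtain ⟨f, hf, h1⟩ := hs s subset_rfl
      obtain ⟨g, hg, h2⟩ := hs ∅ (Finset.empty_subset _)
      have h1 := (h1 q hq).2 hq
      have h2 := mt (h2 q hq).1 (Finset.notMem_empty _)
      rw [hfalse, mem_regressors_false p hf] at h1
      rw [hfalse, mem_regressors_false p hg] at h2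
      exact h2 h1
    have hle : ∀ q ∈ s, ∀ r ∈ s, ¬ q.2 < r.2 := by
      intro q hq r hr hlt
      obtain ⟨f, -, h⟩ := hs {r} (by simpa using hr)
      have h1 := (h r hr).2 (Finset.mem_singleton_self r)
      have h2 := (h q hq).1
      rw [htrue r hr] at h1
      rw [htrue q hq] at h2
      have h3 := Finset.mem_singleton.1 (h2 (hlt.trans h1))
      rw [h3] at hlt
      exact lt_irrefl _ hlt
    have : s.card ≤ 1 := by
      refine Finset.card_le_one.2 fun q hq r hr => ?_
      refine Prod.ext ((htrue q hq).trans (htrue r hr).symm) ?_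
      exact le_antisymm (not_lt.1 (hle r hr q hq)) (not_lt.1 (hle q hq r hr))
    exact_mod_cast this
  · have hs : PseudoShatters (twoPointProblem p).regressors {(true, (1 / 2 : ℝ))} := by
      intro t ht
      by_cases h : (true, (1 / 2 : ℝ)) ∈ t
      · obtain ⟨f, hf, h1⟩ := exists_mem_regressors p (b := 1) (by simp)
        refine ⟨f, hf, fun q hq => ?_⟩
        rw [Finset.mem_singleton.1 hq]
        simp only [h1, h, iff_true]
        norm_num
      · obtain ⟨f, hf, h1⟩ := exists_mem_regressors p (b := 0) (by simp)
        refine ⟨f, hf, fun q hq => ?_⟩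
        rw [Finset.mem_singleton.1 hq]
        simp only [h1, h, iff_false]
        norm_num
    refine le_trans ?_ (le_iSup₂ _ hs)
    simp

/-- Members of the class can differ only at `true`, so this is Chebyshev's inequality: a difference
above `γ'` at `true` forces `γ' ^ 2 * μ {true} ≤ ε' ^ 2`. The truncation at `1` gives equality. -/
theorem disagreementSup_twoPoint {γ : ℝ} (hγ : 0 < γ) :
    disagreementSup (twoPointProblem p).regressors γ = 1 := by
  apply le_antisymm
  · refine iSup₂_le fun g hg => iSup₂_le fun ι hι => ?_
    refine sup_le (iSup_le fun μ => iSup₂_le fun γ' ε' => iSup₂_le fun hγ' hε' => ?_) le_rfl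
    have hγ'0 : 0 < γ' := by linarith
    have hε'0 : 0 < ε' := by linarith
    set s := {x | ∃ f ∈ (twoPointProblem p).regressors, γ' < |f x - g x| ∧
      Real.sqrt (∫ u, (f u - g u) ^ 2 ∂(μ : Measure Bool)) ≤ ε'} with hsdef
    rcases s.eq_empty_or_nonempty with hs | ⟨x, f, hf, hx, hint⟩
    · simp [hs]
    have hfalse : f false - g false = 0 := by
      rw [mem_regressors_false p hf, mem_regressors_false p hg, sub_self]
    have hsub : s ⊆ {true} := by
      rintro x ⟨f', hf', hx', -⟩
      cases x
      · rw [mem_regressors_false p hf', mem_regressors_false p hg, sub_self, abs_zero] at hx'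
        exact absurd hx' (not_lt.2 hγ'0.le)
      · rfl
    have hxt : γ' < |f true - g true| := by
      cases x
      · rw [hfalse, abs_zero] at hx
        exact absurd hx (not_lt.2 hγ'0.le)
      · exact hx
    have hI : ∫ u, (f u - g u) ^ 2 ∂(μ : Measure Bool) =
        (μ : Measure Bool).real {true} * (f true - g true) ^ 2 := by
      rw [integral_fintype .of_finite]
      simp [hfalse]
    rw [Real.sqrt_le_left hε'0.le, hI] at hint
    have hm : γ' ^ 2 * (μ : Measure Bool).real {true} ≤ ε' ^ 2 := by
      have : γ' ^ 2 ≤ (f true - g true) ^ 2 := by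
        rw [← sq_abs (f true - g true)]
        exact pow_le_pow_left₀ hγ'0.le hxt.le 2
      nlinarith [measureReal_nonneg (μ := (μ : Measure Bool)) (s := {true})]
    calc ENNReal.ofReal (γ' ^ 2 / ε' ^ 2) * (μ : Measure Bool) s
        ≤ ENNReal.ofReal (γ' ^ 2 / ε' ^ 2) * (μ : Measure Bool) {true} := by gcongr
      _ = ENNReal.ofReal (γ' ^ 2 / ε' ^ 2 * (μ : Measure Bool).real {true}) := by
          rw [ENNReal.ofReal_mul (by positivity), ofReal_measureReal]
      _ ≤ 1 := by
          rw [ENNReal.ofReal_le_one, div_mul_eq_mul_div]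
          exact div_le_one_of_le₀ hm (by positivity)
  · obtain ⟨g, hg, -⟩ := exists_mem_regressors p (b := 0) (by simp)
    refine le_trans ?_ (le_iSup₂ g hg)
    refine le_trans ?_ (le_iSup₂ (1 : ℝ) one_pos)
    exact le_sup_right

end Basic

section

/-! ### Lower bound for uncertainty-based learners -/

instance : Finite Feedback :=
  Finite.of_surjective (fun o : Option Bool => o.elim Feedback.hidden Feedback.revealed) (by
    rintro (_ | y)
    · exact ⟨none, rfl⟩
    · exact ⟨some y, rfl⟩)

instance : DiscreteMeasurableSpace Feedback := ⟨fun _ => trivial⟩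

/-! ### Histories of a budgeted learner and their measurability. -/

/-- The number of labels revealed in a history. -/
noncomputable def revealedCount {X : Type} {t : ℕ} (h : Fin t → X × Feedback) : ℕ :=
  Nat.card {i : Fin t // (h i).2 ≠ Feedback.hidden}

open Classical in
theorem revealedCount_snoc {X : Type} {t : ℕ} (h : Fin t → X × Feedback) (q : X × Feedback) :
    revealedCount (Fin.snoc (α := fun _ => X × Feedback) h q) =
      revealedCount h + if q.2 ≠ Feedback.hidden then 1 else 0 := by
  simp only [revealedCount, Nat.card_eq_fintype_card, Fintype.card_subtype, Finset.card_filter]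
  rw [Fin.sum_univ_castSucc]
  simp only [Fin.snoc_castSucc, Fin.snoc_last]

namespace ActiveLearner

section

variable {X : Type} [MeasurableSpace X] (L : ActiveLearner X) (B : ℕ)

open Classical in
/-- What the learner sees in round `t`. -/
noncomputable def feedback (s : L.Seed) (z : ℕ → X × Bool) (t : ℕ) : X × Feedback :=
  ((z t).1, if L.asks t s (L.history B s z t) (z t).1 = true ∧
      revealedCount (L.history B s z t) < B then Feedback.revealed (z t).2 else Feedback.hidden)

theorem history_succ (s : L.Seed) (z : ℕ → X × Bool) (t : ℕ) :
    L.history B s z (t + 1) =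
      Fin.snoc (α := fun _ => X × Feedback) (L.history B s z t) (L.feedback B s z t) := rfl

theorem observed_eq (s : L.Seed) (z : ℕ → X × Bool) : L.observed B s z = L.feedback B s z := by
  ext1 t
  rw [observed, history_succ, Fin.snoc_last]

theorem measurable_snoc {Y Ω : Type*} [MeasurableSpace Y] [MeasurableSpace Ω] {t : ℕ}
    {f : Ω → Fin t → Y} {g : Ω → Y} (hf : Measurable f) (hg : Measurable g) :
    Measurable fun ω => (Fin.snoc (α := fun _ => Y) (f ω) (g ω) : Fin (t + 1) → Y) := by
  refine measurable_pi_iff.2 fun i => ?_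
  refine Fin.lastCases ?_ (fun j => ?_) i
  · simpa only [Fin.snoc_last] using hg
  · simp only [Fin.snoc_castSucc]
    exact (measurable_pi_apply j).comp hf

theorem measurable_feedback_of [Finite X] [DiscreteMeasurableSpace X] {t : ℕ}
    (h : Measurable fun q : L.Seed × (ℕ → X × Bool) => L.history B q.1 q.2 t) :
    Measurable fun q : L.Seed × (ℕ → X × Bool) => L.feedback B q.1 q.2 t := by
  classical
  have hz : Measurable fun q : L.Seed × (ℕ → X × Bool) => q.2 t :=
    (measurable_pi_apply t).comp measurable_snd
  have hask := (L.measurable_asks t).comp (measurable_fst.prodMk (h.prodMk hz.fst))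
  have hcnt : Measurable fun q : L.Seed × (ℕ → X × Bool) =>
      revealedCount (L.history B q.1 q.2 t) :=
    (measurable_of_countable (revealedCount : (Fin t → X × Feedback) → ℕ)).comp h
  refine hz.fst.prodMk (Measurable.ite ?_ ((measurable_of_countable _).comp hz.snd)
    measurable_const)
  exact (hask (measurableSet_singleton true)).inter (hcnt (measurableSet_Iio (a := B)))

theorem measurable_history [Finite X] [DiscreteMeasurableSpace X] (t : ℕ) :
    Measurable fun q : L.Seed × (ℕ → X × Bool) => L.history B q.1 q.2 t := by
  induction t with
  | zero => exact measurable_of_subsingleton_codomain _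
  | succ t ih => exact measurable_snoc ih (L.measurable_feedback_of B ih)

theorem measurable_observed [Finite X] [DiscreteMeasurableSpace X] :
    Measurable fun q : L.Seed × (ℕ → X × Bool) => L.observed B q.1 q.2 := by
  simp_rw [observed_eq]
  exact measurable_pi_iff.2 fun t => L.measurable_feedback_of B (L.measurable_history B t)

theorem measurable_output_observed [Finite X] [DiscreteMeasurableSpace X] (x : X) :
    Measurable fun q : L.Seed × (ℕ → X × Bool) => L.output q.1 (L.observed B q.1 q.2) x :=
  L.measurable_output.comp
    (measurable_fst.prodMk ((L.measurable_observed B).prodMk measurable_const))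

end

end ActiveLearner

/-! ### Coupling of the two hypotheses by label reversal. -/

/-- Reversal of the label of the learnable point. -/
def flipLabel (q : Bool × Bool) : Bool × Bool := (q.1, xor q.1 q.2)

theorem measurable_flipLabel : Measurable flipLabel := measurable_of_countable _

variable (p : Icc (0 : ℝ) 1)

theorem map_flipLabel_jointLaw :
    ((twoPointProblem p).jointLaw (labelParam p false)).map flipLabel =
      (twoPointProblem p).jointLaw (labelParam p true) := by
  refine Measure.ext_of_singleton fun q => ?_
  rw [Measure.map_apply measurable_flipLabel (measurableSet_singleton q)]
  have hpre : flipLabel ⁻¹' {q} = {flipLabel q} := by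
    ext ⟨x, b⟩
    obtain ⟨x', b'⟩ := q
    cases x <;> cases b <;> cases x' <;> cases b' <;> simp [flipLabel]
  rw [hpre, ← measureReal_eq_measureReal_iff]
  obtain ⟨x, b⟩ := q
  cases x
  · simp only [flipLabel, Bool.false_xor, jointLaw_real_false]
  · simp only [flipLabel, Bool.true_xor, jointLaw_real_true]
    cases b <;> simp

theorem measurePreserving_flipLabel :
    MeasurePreserving (fun (z : ℕ → Bool × Bool) t => flipLabel (z t))
      ((twoPointProblem p).dataLaw (labelParam p false))
      ((twoPointProblem p).dataLaw (labelParam p true)) := by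
  refine ⟨by have := measurable_flipLabel; fun_prop, ?_⟩
  rw [LinearProblem.dataLaw, Measure.infinitePi_map_pi _ (fun _ => measurable_flipLabel)]
  simp_rw [map_flipLabel_jointLaw]
  rfl

/-- The event that the first `B` examples are all pure noise. -/
def startsNoisy (B : ℕ) : Set (ℕ → Bool × Bool) :=
  Set.pi (Finset.range B : Set ℕ) fun _ => {q | q.1 = false}

theorem measurableSet_startsNoisy (B : ℕ) : MeasurableSet (startsNoisy B) :=
  MeasurableSet.pi (Finset.countable_toSet _) fun _ _ => MeasurableSet.of_discrete

theorem measureReal_startsNoisy (w : (twoPointProblem p).params) (B : ℕ) :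
    ((twoPointProblem p).dataLaw w).real (startsNoisy B) = (1 - p) ^ B := by
  have h : ((twoPointProblem p).jointLaw w).real {q | q.1 = false} = 1 - p := by
    have hset : {q : Bool × Bool | q.1 = false} = {(false, true)} ∪ {(false, false)} := by
      ext ⟨x, b⟩
      cases x <;> cases b <;> simp
    rw [hset, measureReal_union (by simp) (measurableSet_singleton _),
      jointLaw_real_false, jointLaw_real_false]
    ring
  rw [Measure.real, LinearProblem.dataLaw, startsNoisy,
    Measure.infinitePi_pi _ (fun _ _ => MeasurableSet.of_discrete), ENNReal.toReal_prod]
  change ∏ _i ∈ Finset.range B, ((twoPointProblem p).jointLaw w).real {q | q.1 = false} = _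
  rw [h, Finset.prod_const, Finset.card_range]

/-- While the budget lasts, each of the first `B` examples is a noise point and costs one label;
hence a label can be revealed at time `t` only if `t < B`. -/
theorem le_revealedCount {L : ActiveLearner Bool} {B : ℕ} {s : L.Seed} {z : ℕ → Bool × Bool}
    (hz : z ∈ startsNoisy B) (hask : ∀ t, L.asks t s (L.history B s z t) false = true) (t : ℕ) :
    min t B ≤ revealedCount (L.history B s z t) := by
  induction t with
  | zero => simp
  | succ t ih =>
    rw [L.history_succ, revealedCount_snoc]
    by_cases h : revealedCount (L.history B s z t) < B
    · have ht : t < B := by omega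
      have hx : (z t).1 = false := hz t (by simpa using ht)
      have : (L.feedback B s z t).2 ≠ Feedback.hidden := by
        simp [ActiveLearner.feedback, hx, hask t, h]
      rw [if_pos this]
      omega
    · omega

/-- If the budget is spent on pure noise, the label of the learnable point is never seen. -/
theorem observed_flipLabel {L : ActiveLearner Bool} {B : ℕ} {s : L.Seed} {z : ℕ → Bool × Bool}
    (hz : z ∈ startsNoisy B) (hask : ∀ t, L.asks t s (L.history B s z t) false = true) :
    L.observed B s (fun t => flipLabel (z t)) = L.observed B s z := by
  have hfeed : ∀ t, L.history B s (fun t => flipLabel (z t)) t = L.history B s z t →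
      L.feedback B s (fun t => flipLabel (z t)) t = L.feedback B s z t := by
    intro t ht
    simp only [ActiveLearner.feedback, ht]
    refine Prod.ext rfl ?_
    change (if L.asks t s (L.history B s z t) (z t).1 = true ∧ _ then _ else _) = _
    refine ite_congr rfl (fun h => ?_) (fun _ => rfl)
    -- A revealed label comes before time `B`, hence from the noise point, which the reversal does
    -- not touch.
    have ht : t < B := by
      have := le_revealedCount hz hask t
      omega
    have hx : (z t).1 = false := hz t (by simpa using ht)
    simp [flipLabel, hx]
  have hhist : ∀ t, L.history B s (fun t => flipLabel (z t)) t = L.history B s z t := by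
    intro t
    induction t with
    | zero => rfl
    | succ t ih => rw [L.history_succ, L.history_succ, ih, hfeed t ih]
  rw [L.observed_eq, L.observed_eq]
  exact funext fun t => hfeed t (hhist t)

/-- Both runs are realized on the space of the hypothesis `false`, the other one through the label
reversal. On `startsNoisy B` they produce the same classifier, which is wrong at `true` under
exactly one hypothesis, so the two excesses add up to `p`. -/
theorem expectedExcess_lower_bound {L : ActiveLearner Bool} {B : ℕ}
    (hL : L.UncertaintyBased (twoPointProblem p) B) :
    p * (1 - p) ^ B / 2 ≤ L.expectedExcess (twoPointProblem p) B := by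
  set μ := L.seedLaw.prod ((twoPointProblem p).dataLaw (labelParam p false)) with hμ
  have hflip : MeasurePreserving
      (Prod.map id (fun (z : ℕ → Bool × Bool) t => flipLabel (z t))) μ
      (L.seedLaw.prod ((twoPointProblem p).dataLaw (labelParam p true))) :=
    (MeasurePreserving.id L.seedLaw).prod (measurePreserving_flipLabel p)
  let e : Bool → L.Seed × (ℕ → Bool × Bool) → ℝ := fun y q =>
    (twoPointProblem p).excess (labelParam p y) (L.output q.1 (L.observed B q.1 q.2))
  have hmeas : ∀ y, Measurable (e y) := by
    intro y
    simp only [e, excess_twoPoint]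
    exact (measurable_of_countable (fun b : Bool => if b = y then (0 : ℝ) else p)).comp
      (L.measurable_output_observed B true)
  have hnonneg : ∀ y q, 0 ≤ e y q := by
    intro y q
    simp only [e, excess_twoPoint]
    split_ifs
    exacts [le_rfl, p.2.1]
  have hint : ∀ y (ν : Measure (L.Seed × (ℕ → Bool × Bool))) [IsFiniteMeasure ν],
      Integrable (e y) ν := by
    intro y ν _
    refine Integrable.of_bound (hmeas y).aestronglyMeasurable p (.of_forall fun q => ?_)
    rw [Real.norm_of_nonneg (hnonneg y q)]
    simp only [e, excess_twoPoint]
    split_ifs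
    exacts [p.2.1, le_rfl]
  have hcomp : Integrable
      (fun q => e true (Prod.map id (fun (z : ℕ → Bool × Bool) t => flipLabel (z t)) q)) μ :=
    (hflip.integrable_comp (hmeas true).aestronglyMeasurable).2 (hint true _)
  have hE : MeasurableSet (Prod.snd ⁻¹' startsNoisy B : Set (L.Seed × (ℕ → Bool × Bool))) :=
    measurable_snd (measurableSet_startsNoisy B)
  have key : ∫ q, (Prod.snd ⁻¹' startsNoisy B).indicator (fun _ => (p : ℝ)) q ∂μ ≤
      ∫ q, (e true (Prod.map id (fun (z : ℕ → Bool × Bool) t => flipLabel (z t)) q) +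
        e false q) ∂μ := by
    refine integral_mono_ae ((integrable_const _).indicator hE) (hcomp.add (hint false μ)) ?_
    filter_upwards [hL.1 _ (labelParam_mem_support p false)] with q hq
    by_cases hz : q.2 ∈ startsNoisy B
    · have hask : ∀ t, L.asks t q.1 (L.history B q.1 q.2 t) false = true := by
        intro t
        have := hq t false
        rw [reg_twoPoint_false] at this
        exact hL.2 _ _ _ _ this
      rw [indicator_of_mem (by exact hz)]
      simp only [e, Prod.map, id, observed_flipLabel hz hask, excess_twoPoint]
      cases L.output q.1 (L.observed B q.1 q.2) true <;> simp
    · rw [indicator_of_notMem (by exact hz)]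
      exact add_nonneg (hnonneg _ _) (hnonneg _ _)
  have hprob : μ.real (Prod.snd ⁻¹' startsNoisy B) = (1 - p) ^ B := by
    rw [← measureReal_startsNoisy p (labelParam p false) B]
    have := (measurePreserving_snd (μ := L.seedLaw)
      (ν := (twoPointProblem p).dataLaw (labelParam p false))).measureReal_preimage
        (measurableSet_startsNoisy B).nullMeasurableSet
    exact this
  rw [integral_indicator_const _ hE, hprob, integral_add hcomp (hint false μ),
    ← integral_map hflip.measurable.aemeasurable (hmeas true).aestronglyMeasurable,
    hflip.map_eq] at key
  rw [ActiveLearner.expectedExcess, tsum_prior_mul]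
  rw [smul_eq_mul] at key
  linarith

end

section

/-! ### Tail bounds for the number of visits to the learnable point -/

/-- The number of the first `t` examples that fall on the point `true`. -/
def visits (z : ℕ → Bool × Bool) (t : ℕ) : ℕ := ((List.range t).filter (fun i => (z i).1)).length

theorem visits_succ (z : ℕ → Bool × Bool) (t : ℕ) :
    visits z (t + 1) = visits z t + if (z t).1 then 1 else 0 := by
  unfold visits
  rw [List.range_succ, List.filter_append, List.length_append]
  cases h : (z t).1 <;> simp [h]

theorem visits_mono (z : ℕ → Bool × Bool) : Monotone (visits z) :=
  monotone_nat_of_le_succ fun t => by rw [visits_succ]; omega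

theorem visits_eq_sum (z : ℕ → Bool × Bool) (t : ℕ) :
    (visits z t : ℝ) = ∑ i ∈ Finset.range t, if (z i).1 then (1 : ℝ) else 0 := by
  induction t with
  | zero => simp [visits]
  | succ t ih =>
    rw [visits_succ, Finset.sum_range_succ, ← ih]
    push_cast
    rfl

variable (p : Icc (0 : ℝ) 1) (y : Bool)

open ProbabilityTheory in
theorem mgf_visits (t : ℕ) (c : ℝ) :
    mgf (fun z => (visits z t : ℝ)) ((twoPointProblem p).dataLaw (labelParam p y)) c =
      (1 + p * (Real.exp c - 1)) ^ t := by
  let u : Bool × Bool → ℝ := fun q => if q.1 then 1 else 0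
  have hu : Measurable u := measurable_of_countable u
  have hind : iIndepFun (fun (i : ℕ) (z : ℕ → Bool × Bool) => u (z i))
      ((twoPointProblem p).dataLaw (labelParam p y)) :=
    iIndepFun_infinitePi (P := fun _ : ℕ => (twoPointProblem p).jointLaw (labelParam p y))
      (X := fun _ => u) (fun _ => hu)
  have hsum : (fun z => (visits z t : ℝ)) =
      ∑ i ∈ Finset.range t, (fun z : ℕ → Bool × Bool => u (z i)) := by
    ext z
    rw [visits_eq_sum, Finset.sum_apply]
  rw [hsum, hind.mgf_sum (fun i => hu.comp (measurable_pi_apply i))]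
  have hone : ∀ i : ℕ, mgf (fun z : ℕ → Bool × Bool => u (z i))
      ((twoPointProblem p).dataLaw (labelParam p y)) c = 1 + p * (Real.exp c - 1) := by
    intro i
    have hmap := (measurePreserving_eval_infinitePi
      (fun _ : ℕ => (twoPointProblem p).jointLaw (labelParam p y)) i)
    have : mgf (fun z : ℕ → Bool × Bool => u (z i))
        ((twoPointProblem p).dataLaw (labelParam p y)) c =
        ∫ q, Real.exp (c * u q) ∂((twoPointProblem p).jointLaw (labelParam p y)) := by
      rw [← hmap.map_eq, integral_map hmap.measurable.aemeasurable
        (Measurable.aestronglyMeasurable (measurable_of_countable _))]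
      rfl
    rw [this, integral_fintype .of_finite, Fintype.sum_prod_type]
    simp only [Fintype.sum_bool, jointLaw_real_false, jointLaw_real_true]
    cases y <;> simp [u] <;> ring
  simp [hone]

theorem integrable_exp_visits (t : ℕ) (c : ℝ) :
    Integrable (fun z => Real.exp (c * (visits z t : ℝ)))
      ((twoPointProblem p).dataLaw (labelParam p y)) := by
  have hm : Measurable (fun z : ℕ → Bool × Bool => (visits z t : ℝ)) := by
    simp_rw [visits_eq_sum]
    refine Finset.measurable_sum _ fun i _ => ?_
    exact (measurable_of_countable (fun q : Bool × Bool => if q.1 then (1 : ℝ) else 0)).comp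
      (measurable_pi_apply i)
  refine Integrable.of_bound (hm.const_mul c).exp.aestronglyMeasurable (Real.exp (|c| * t))
    (.of_forall fun z => ?_)
  rw [Real.norm_eq_abs, abs_of_pos (Real.exp_pos _)]
  have h1 : (visits z t : ℝ) ≤ t := by
    have : visits z t ≤ t := by
      unfold visits
      exact (List.length_filter_le _ _).trans_eq List.length_range
    exact_mod_cast this
  exact Real.exp_le_exp.2 (mul_le_mul (le_abs_self c) h1 (Nat.cast_nonneg _) (abs_nonneg c))

/-- Chernoff bound with parameter `1`, using `exp 1 - 1 ≤ 2` and `1 + 2 * p ≤ exp (2 * p)`. -/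
theorem measure_le_visits (t : ℕ) (a : ℝ) :
    ((twoPointProblem p).dataLaw (labelParam p y)) {z | a ≤ visits z t} ≤
      ENNReal.ofReal (Real.exp (2 * p * t - a)) := by
  have hp := p.2.1
  rw [← ofReal_measureReal]
  refine ENNReal.ofReal_le_ofReal ?_
  refine (ProbabilityTheory.measure_ge_le_exp_mul_mgf a zero_le_one
    (integrable_exp_visits p y t 1)).trans ?_
  have he : Real.exp 1 ≤ 3 := by linarith [Real.exp_one_lt_d9]
  have he' : 1 ≤ Real.exp 1 := by linarith [Real.add_one_le_exp (1 : ℝ)]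
  rw [mgf_visits, show 2 * (p : ℝ) * t - a = -1 * a + t * (2 * p) by ring, Real.exp_add,
    Real.exp_nat_mul]
  gcongr
  calc 1 + (p : ℝ) * (Real.exp 1 - 1) ≤ 2 * p + 1 := by nlinarith
    _ ≤ Real.exp (2 * p) := Real.add_one_le_exp _

/-- Chernoff bound with parameter `-1`, using `exp (-1) - 1 ≤ -1/2`. -/
theorem measure_visits_le (t : ℕ) (a : ℝ) :
    ((twoPointProblem p).dataLaw (labelParam p y)) {z | visits z t ≤ a} ≤
      ENNReal.ofReal (Real.exp (a - p * t / 2)) := by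
  have hp := p.2.1
  have hp1 := p.2.2
  rw [← ofReal_measureReal]
  refine ENNReal.ofReal_le_ofReal ?_
  refine (ProbabilityTheory.measure_le_le_exp_mul_mgf a (neg_nonpos.2 zero_le_one)
    (integrable_exp_visits p y t (-1))).trans ?_
  have he : Real.exp (-1) ≤ 1 / 2 := by
    rw [Real.exp_neg, inv_eq_one_div]
    exact one_div_le_one_div_of_le two_pos (by linarith [Real.add_one_le_exp (1 : ℝ)])
  have he' := Real.exp_pos (-1)
  rw [mgf_visits, show a - (p : ℝ) * t / 2 = - -1 * a + t * (-p / 2) by ring, Real.exp_add,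
    Real.exp_nat_mul]
  gcongr
  · nlinarith
  · calc 1 + (p : ℝ) * (Real.exp (-1) - 1) ≤ -p / 2 + 1 := by nlinarith
      _ ≤ Real.exp (-p / 2) := Real.add_one_le_exp _

end

open EpochAlgorithm

/-! ### The epoch-based algorithm on the two-point problem -/

theorem signLabel_response (y : Bool) : signLabel (response y) = y := by
  cases y <;> simp [signLabel, response]

theorem loss_replicate {X : Type} (f : X → ℝ) (n : ℕ) (x : X) (y : Bool) :
    loss f (List.replicate n (x, y)) = n * (f x - response y) ^ 2 := by
  simp [loss]

theorem length_filter_range' (z : ℕ → Bool × Bool) {a b : ℕ} (h : a ≤ b) :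
    ((List.range' a (b - a)).filter (fun i => (z i).1)).length = visits z b - visits z a := by
  have : List.range b = List.range a ++ List.range' a (b - a) := by
    rw [List.range_eq_range', List.range_eq_range']
    have := List.range'_append (s := 0) (m := a) (n := b - a) (step := 1)
    simp only [zero_add, one_mul] at this
    rw [this, Nat.add_sub_cancel' h]
  simp only [visits, this, List.filter_append, List.length_append]
  omega

theorem epochEnd_mono : Monotone epochEnd := by
  refine monotone_nat_of_le_succ fun m => ?_
  simp only [epochEnd, Nat.add_eq_zero_iff, one_ne_zero, and_false, if_false]
  split_ifs
  · exact Nat.zero_le _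
  · exact Nat.pow_le_pow_right two_pos (Nat.le_succ m)

section Oracle

variable {p : Icc (0 : ℝ) 1} {oracle : List (Bool × Bool) → Bool → ℝ} {γ : ℝ} {y : Bool}

/-- All values at `false` equal `1/2`, so the open interval there is empty. An empty active set
gives infimum and supremum the default value `0`, with the same outcome. -/
theorem not_queries_false (b : ℝ) (S : List (Bool × Bool)) :
    ¬ Queries (twoPointProblem p).regressors oracle γ b S false := by
  rintro ⟨h, -⟩
  set A := activeSet (twoPointProblem p).regressors oracle b S
  have hsub : (fun f : Bool → ℝ => f false) '' A ⊆ {1 / 2} := by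
    rintro _ ⟨f, hf, rfl⟩
    exact mem_regressors_false p hf.1
  rw [EpochAlgorithm.lcb, EpochAlgorithm.ucb] at h
  rcases subset_singleton_iff_eq.1 hsub with h' | h'
  · rw [h', Real.sInf_empty, Real.sSup_empty] at h
    exact lt_irrefl _ (h.1.trans h.2)
  · rw [h', csInf_singleton, csSup_singleton] at h
    exact lt_irrefl _ h.1

theorem bddBelow_activeSet (b : ℝ) (S : List (Bool × Bool)) :
    BddBelow ((fun f : Bool → ℝ => f true) ''
      activeSet (twoPointProblem p).regressors oracle b S) := by
  refine ⟨0, ?_⟩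
  rintro _ ⟨f, hf, rfl⟩
  exact (mem_regressors_true p hf.1).1

theorem bddAbove_activeSet (b : ℝ) (S : List (Bool × Bool)) :
    BddAbove ((fun f : Bool → ℝ => f true) ''
      activeSet (twoPointProblem p).regressors oracle b S) := by
  refine ⟨1, ?_⟩
  rintro _ ⟨f, hf, rfl⟩
  exact (mem_regressors_true p hf.1).2

theorem loss_oracle_replicate (hor : IsRegressionOracle (twoPointProblem p).regressors oracle)
    (n : ℕ) : loss (oracle (List.replicate n (true, y))) (List.replicate n (true, y)) = 0 := by
  refine le_antisymm ?_ ?_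
  · refine ((hor _).2 _ ⟨labelParam p y, rfl⟩).trans_eq ?_
    rw [loss_replicate, reg_labelParam_true]
    simp
  · rw [loss_replicate]
    positivity

theorem mem_activeSet_replicate
    (hor : IsRegressionOracle (twoPointProblem p).regressors oracle) {n : ℕ} {b : ℝ}
    {f : Bool → ℝ} :
    f ∈ activeSet (twoPointProblem p).regressors oracle b (List.replicate n (true, y)) ↔
      f ∈ (twoPointProblem p).regressors ∧ n * (f true - response y) ^ 2 ≤ b := by
  rw [activeSet, mem_ofPred_eq, loss_oracle_replicate hor, loss_replicate, zero_add]

theorem reg_labelParam_mem_activeSet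
    (hor : IsRegressionOracle (twoPointProblem p).regressors oracle) (n : ℕ) {b : ℝ} (hb : 0 ≤ b) :
    (twoPointProblem p).reg (labelParam p y) ∈
      activeSet (twoPointProblem p).regressors oracle b (List.replicate n (true, y)) := by
  refine (mem_activeSet_replicate hor).2 ⟨⟨_, rfl⟩, ?_⟩
  rw [reg_labelParam_true]
  simpa using hb

/-- The true function stays active with value `0` or `1` at `true`, and neither lies within `γ <
1/2` of `1/2`. -/
theorem classifier_true_ne_none
    (hor : IsRegressionOracle (twoPointProblem p).regressors oracle) (n : ℕ) {b : ℝ} (hb : 0 ≤ b)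
    (hγ : γ < 1 / 2) :
    classifier (twoPointProblem p).regressors oracle γ b (List.replicate n (true, y)) true ≠
      none := by
  have hmem := reg_labelParam_mem_activeSet (y := y) hor n hb
  have h1 := csInf_le (bddBelow_activeSet b _) (mem_image_of_mem (fun f : Bool → ℝ => f true) hmem)
  have h2 := le_csSup (bddAbove_activeSet b _) (mem_image_of_mem (fun f : Bool → ℝ => f true) hmem)
  simp only [reg_labelParam_true] at h1 h2
  rw [classifier, if_neg]
  · simp
  · intro hsub
    have h3 := hsub ⟨h1, h2⟩
    cases y
    · simp only [response, Bool.false_eq_true, if_false] at h3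
      linarith [h3.1]
    · simp only [response, if_true] at h3
      linarith [h3.2]

theorem queries_true_iff (hor : IsRegressionOracle (twoPointProblem p).regressors oracle)
    (n : ℕ) {b : ℝ} (hb : 0 ≤ b) (hγ : γ < 1 / 2) :
    Queries (twoPointProblem p).regressors oracle γ b (List.replicate n (true, y)) true ↔
      (∃ f ∈ (twoPointProblem p).regressors, n * (f true - response y) ^ 2 ≤ b ∧ f true < 1 / 2) ∧
      ∃ f ∈ (twoPointProblem p).regressors, n * (f true - response y) ^ 2 ≤ b ∧ 1 / 2 < f true := by
  have hne := Set.Nonempty.image (fun f : Bool → ℝ => f true)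
    ⟨_, reg_labelParam_mem_activeSet (y := y) hor n hb⟩
  rw [Queries, and_iff_left (classifier_true_ne_none hor n hb hγ), mem_Ioo, EpochAlgorithm.lcb,
    EpochAlgorithm.ucb, csInf_lt_iff (bddBelow_activeSet b _) hne,
    lt_csSup_iff (bddAbove_activeSet b _) hne]
  simp only [exists_mem_image, mem_activeSet_replicate hor, and_assoc]

theorem Queries.mono (hor : IsRegressionOracle (twoPointProblem p).regressors oracle)
    {n : ℕ} {b b' : ℝ} (hb : 0 ≤ b) (hbb' : b ≤ b') (hγ : γ < 1 / 2)
    (h : Queries (twoPointProblem p).regressors oracle γ b (List.replicate n (true, y)) true) :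
    Queries (twoPointProblem p).regressors oracle γ b' (List.replicate n (true, y)) true := by
  rw [queries_true_iff hor n hb hγ] at h
  rw [queries_true_iff hor n (hb.trans hbb') hγ]
  obtain ⟨⟨f, hf, h1, h2⟩, g, hg, h3, h4⟩ := h
  exact ⟨⟨f, hf, h1.trans hbb', h2⟩, g, hg, h3.trans hbb', h4⟩

/-- A query requires an active function on the wrong side of `1/2`, whose loss is at least `1/4` per
label. -/
theorem Queries.le_four_mul (hor : IsRegressionOracle (twoPointProblem p).regressors oracle)
    {n : ℕ} {b : ℝ} (hb : 0 ≤ b) (hγ : γ < 1 / 2)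
    (h : Queries (twoPointProblem p).regressors oracle γ b (List.replicate n (true, y)) true) :
    (n : ℝ) ≤ 4 * b := by
  rw [queries_true_iff hor n hb hγ] at h
  obtain ⟨⟨f, -, h1, h2⟩, g, -, h3, h4⟩ := h
  have hn : (0 : ℝ) ≤ n := Nat.cast_nonneg n
  cases y
  · simp only [response, Bool.false_eq_true, if_false, sub_zero] at h3
    nlinarith [mul_le_mul_of_nonneg_left (show (1 / 4 : ℝ) ≤ g true ^ 2 by nlinarith) hn]
  · simp only [response, if_true] at h1
    nlinarith [mul_le_mul_of_nonneg_left (show (1 / 4 : ℝ) ≤ (f true - 1) ^ 2 by nlinarith) hn]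

theorem queries_nil (hor : IsRegressionOracle (twoPointProblem p).regressors oracle)
    {b : ℝ} (hb : 0 ≤ b) (hγ : γ < 1 / 2) :
    Queries (twoPointProblem p).regressors oracle γ b [] true := by
  obtain ⟨f, hf, hf0⟩ := exists_mem_regressors p (b := 0) (by simp)
  obtain ⟨g, hg, hg1⟩ := exists_mem_regressors p (b := 1) (by simp)
  refine (queries_true_iff (y := true) hor 0 hb hγ).2 ⟨⟨f, hf, by simpa using hb, ?_⟩,
    g, hg, by simpa using hb, ?_⟩
  · rw [hf0]; norm_num
  · rw [hg1]; norm_num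

/-- The true function fits the sample exactly, so every minimizer has zero loss and takes the
correct value at `true`. -/
theorem classifier_true_of_pos (hor : IsRegressionOracle (twoPointProblem p).regressors oracle)
    {n : ℕ} (hn : n ≠ 0) {b : ℝ} (hb : 0 ≤ b) (hγ : γ < 1 / 2) :
    classifier (twoPointProblem p).regressors oracle γ b (List.replicate n (true, y)) true =
      some y := by
  have hne := classifier_true_ne_none (y := y) hor n hb hγ
  have hval : oracle (List.replicate n (true, y)) true = response y := by
    have h := loss_oracle_replicate (y := y) hor n
    rw [loss_replicate] at h
    have hn' : (n : ℝ) ≠ 0 := Nat.cast_ne_zero.2 hn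
    have := (mul_eq_zero.1 h).resolve_left hn'
    linarith [pow_eq_zero_iff (two_ne_zero) |>.1 this]
  rw [classifier] at hne ⊢
  split_ifs at hne ⊢ with h
  · exact absurd rfl hne
  · rw [hval, signLabel_response]

/-! ### The sample collected along a run. -/

section Run

variable {z : ℕ → Bool × Bool} {β : ℕ → ℝ}

/-- This reduces the state of the algorithm to a single number, the length of the sample. -/
theorem queried_eq_replicate (hz : ∀ t, (z t).1 = true → (z t).2 = y) (m : ℕ) :
    queried (twoPointProblem p).regressors oracle γ β z m =
      List.replicate (queried (twoPointProblem p).regressors oracle γ β z m).length (true, y) := by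
  induction m with
  | zero => rfl
  | succ m ih =>
    refine List.eq_replicate_iff.2 ⟨rfl, fun q hq => ?_⟩
    rw [queried, List.mem_append] at hq
    rcases hq with hq | hq
    · rw [ih] at hq
      exact List.eq_of_mem_replicate hq
    · obtain ⟨i, hi, rfl⟩ := List.mem_map.1 hq
      have hQ := (List.mem_filter.1 hi).2
      simp only [decide_eq_true_eq] at hQ
      have hx : (z i).1 = true := by
        by_contra hne
        rw [Bool.not_eq_true] at hne
        rw [hne] at hQ
        exact not_queries_false _ _ hQ
      exact Prod.ext hx (hz i hx)

theorem length_queried_succ_of_queries (m : ℕ)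
    (h : Queries (twoPointProblem p).regressors oracle γ (β (m + 1))
      (queried (twoPointProblem p).regressors oracle γ β z m) true) :
    (queried (twoPointProblem p).regressors oracle γ β z (m + 1)).length =
      (queried (twoPointProblem p).regressors oracle γ β z m).length +
        (visits z (epochEnd (m + 1)) - visits z (epochEnd m)) := by
  rw [queried, List.length_append, List.length_map,
    ← length_filter_range' z (epochEnd_mono (Nat.le_succ m))]
  congr 2
  refine List.filter_congr fun i _ => ?_
  cases hx : (z i).1
  · simpa using not_queries_false _ _
  · simpa using h

theorem queried_succ_of_not_queries (m : ℕ)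
    (h : ¬ Queries (twoPointProblem p).regressors oracle γ (β (m + 1))
      (queried (twoPointProblem p).regressors oracle γ β z m) true) :
    queried (twoPointProblem p).regressors oracle γ β z (m + 1) =
      queried (twoPointProblem p).regressors oracle γ β z m := by
  rw [queried, List.append_right_eq_self, List.map_eq_nil_iff, List.filter_eq_nil_iff]
  intro i _
  cases hx : (z i).1
  · simpa using not_queries_false _ _
  · simpa using h

/-- Label complexity: once the visits up to time `2 ^ j` exceed all thresholds, no later label is
queried. -/
theorem length_queried_le (hor : IsRegressionOracle (twoPointProblem p).regressors oracle)
    (hγ : γ < 1 / 2) (hz : ∀ t, (z t).1 = true → (z t).2 = y) {M j B : ℕ} (hj : 1 ≤ j)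
    (hβ : ∀ m ≤ M, 0 ≤ β m) (hanti : Antitone β) (hB : visits z (2 ^ j) ≤ B)
    (hK : M ≤ j ∨ ∀ m, 1 ≤ m → 4 * β m < visits z (2 ^ j)) :
    ∀ m ≤ M, (queried (twoPointProblem p).regressors oracle γ β z m).length ≤ B := by
  -- Invariant: either every visit so far has been queried, or querying has stopped; in both cases
  -- the sample has at most `B` labels.
  have hinv : ∀ m ≤ M,
      ((queried (twoPointProblem p).regressors oracle γ β z m).length = visits z (epochEnd m) ∧
        visits z (epochEnd m) ≤ B) ∨
      ((queried (twoPointProblem p).regressors oracle γ β z m).length ≤ B ∧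
        ¬ Queries (twoPointProblem p).regressors oracle γ (β m)
          (queried (twoPointProblem p).regressors oracle γ β z m) true) := by
    intro m
    induction m with
    | zero => exact fun _ => Or.inl (by simp [queried, epochEnd, visits])
    | succ m ih =>
      intro hm
      by_cases hQ : Queries (twoPointProblem p).regressors oracle γ (β (m + 1))
          (queried (twoPointProblem p).regressors oracle γ β z m) true
      · have hrep : queried (twoPointProblem p).regressors oracle γ β z m = List.replicate
            (queried (twoPointProblem p).regressors oracle γ β z m).length (true, y) :=
          queried_eq_replicate hz m
        rcases ih (by omega) with ⟨h1, h2⟩ | ⟨-, h2⟩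
        · left
          have hlen : (queried (twoPointProblem p).regressors oracle γ β z (m + 1)).length =
              visits z (epochEnd (m + 1)) := by
            have := visits_mono z (epochEnd_mono (Nat.le_succ m))
            rw [length_queried_succ_of_queries m hQ, h1]
            simp only [Nat.succ_eq_add_one] at this
            omega
          refine ⟨hlen, (visits_mono z ?_).trans hB⟩
          -- A query in epoch `m + 1` means that the visits up to `epochEnd m` are at most `4 * β (m
          -- + 1)`, hence fewer than those up to `2 ^ j`. For `m = 0` the bound is `1 ≤ j` itself.
          have hmj : m + 1 ≤ j := by
            rcases hK with hK | hK
            · omega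
            · rw [hrep] at hQ
              have h3 := (Queries.le_four_mul hor (hβ _ hm) hγ hQ).trans_lt (hK (m + 1) (by omega))
              rw [h1] at h3
              have h4 : visits z (epochEnd m) < visits z (2 ^ j) := by exact_mod_cast h3
              have h5 : epochEnd m < 2 ^ j := (visits_mono z).reflect_lt h4
              rcases Nat.eq_zero_or_pos m with rfl | hm0
              · exact hj
              · rw [epochEnd, if_neg hm0.ne'] at h5
                exact (Nat.pow_lt_pow_iff_right one_lt_two).1 h5
          rw [epochEnd, if_neg (Nat.succ_ne_zero m)]
          exact Nat.pow_le_pow_right two_pos hmj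
        -- Once querying stops it never resumes: the sample stays fixed and the thresholds decrease.
        · rw [hrep] at hQ h2
          exact absurd (Queries.mono hor (hβ _ hm) (hanti (Nat.le_succ m)) hγ hQ) h2
      · right
        have hlen : (queried (twoPointProblem p).regressors oracle γ β z m).length ≤ B := by
          rcases ih (by omega) with ⟨h1, h2⟩ | ⟨h1, -⟩
          · exact h1.trans_le h2
          · exact h1
        rw [queried_succ_of_not_queries m hQ]
        exact ⟨hlen, hQ⟩
  intro m hm
  rcases hinv m hm with ⟨h1, h2⟩ | ⟨h1, -⟩
  · exact h1.trans_le h2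
  · exact h1

/-- On an empty sample the whole class is active, so the first epoch containing a visit to `true`
yields a label. -/
theorem length_queried_ne_zero (hor : IsRegressionOracle (twoPointProblem p).regressors oracle)
    (hγ : γ < 1 / 2) {M : ℕ} (hβ : ∀ m ≤ M, 0 ≤ β m) :
    ∀ m ≤ M, visits z (epochEnd m) ≠ 0 →
      (queried (twoPointProblem p).regressors oracle γ β z m).length ≠ 0 := by
  intro m
  induction m with
  | zero => exact fun _ h => absurd (by simp [epochEnd, visits]) h
  | succ m ih =>
    intro hm hv h
    by_cases h0 : (queried (twoPointProblem p).regressors oracle γ β z m).length = 0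
    · have hQ := queries_nil hor (hβ _ hm) hγ
      rw [← List.length_eq_zero_iff.1 h0] at hQ
      have hv0 := not_not.1 (mt (ih (by omega)) (not_not.2 h0))
      rw [length_queried_succ_of_queries m hQ, h0, hv0] at h
      omega
    · rw [queried, List.length_append] at h
      omega

end Run

end Oracle

/-! ### Existence of regression oracles and almost sure labels -/

theorem exists_isRegressionOracle (p : Icc (0 : ℝ) 1) :
    ∃ oracle, IsRegressionOracle (twoPointProblem p).regressors oracle := by
  let g : ℝ → Bool → ℝ := fun b x => if x then b else 1 / 2
  have hg : ∀ f ∈ (twoPointProblem p).regressors, f = g (f true) := by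
    intro f hf
    ext x
    cases x
    · simpa [g] using mem_regressors_false p hf
    · simp [g]
  have hmin : ∀ S : List (Bool × Bool), ∃ o ∈ (twoPointProblem p).regressors,
      ∀ f ∈ (twoPointProblem p).regressors, loss o S ≤ loss f S := by
    intro S
    have hcont : Continuous fun b => loss (g b) S := by
      unfold loss
      refine continuous_list_sum S fun q _ => ?_
      have : Continuous fun b => g b q.1 := by
        simp only [g]
        split_ifs <;> fun_prop
      fun_prop
    obtain ⟨b, hb, hbmin⟩ := isCompact_Icc.exists_isMinOn
      (nonempty_Icc.2 (zero_le_one' ℝ)) hcont.continuousOn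
    obtain ⟨o, ho, hob⟩ := exists_mem_regressors p hb
    refine ⟨o, ho, fun f hf => ?_⟩
    rw [hg o ho, hob, hg f hf]
    exact hbmin (mem_regressors_true p hf)
  choose o ho using hmin
  exact ⟨o, ho⟩

theorem measure_wrong_label (p : Icc (0 : ℝ) 1) (y : Bool) :
    (twoPointProblem p).dataLaw (labelParam p y) {z | ¬ ∀ t, (z t).1 = true → (z t).2 = y} = 0 := by
  change ∀ᵐ z ∂((twoPointProblem p).dataLaw (labelParam p y)), ∀ t, (z t).1 = true → (z t).2 = y
  refine ae_all_iff.2 fun t => ?_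
  have hjoint : ∀ᵐ q ∂((twoPointProblem p).jointLaw (labelParam p y)), q.1 = true → q.2 = y := by
    rw [ae_iff]
    have hset : {q : Bool × Bool | ¬ (q.1 = true → q.2 = y)} = {(true, !y)} := by
      ext ⟨x, b⟩
      cases x <;> cases b <;> cases y <;> simp
    rw [hset, ← measureReal_eq_zero_iff, jointLaw_real_true]
    cases y <;> simp
  exact (measurePreserving_eval_infinitePi
    (fun _ : ℕ => (twoPointProblem p).jointLaw (labelParam p y)) t).quasiMeasurePreserving.ae hjoint

/-! ### Numerical estimates -/

/-- The scale is chosen so that the expected number of visits `2 ^ j / (2 * B)` lies between `B /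
16` and `B / 8`. -/
theorem exists_time_scale {B : ℕ} (hB : 3 ≤ B) :
    ∃ j : ℕ, 1 ≤ j ∧ (2 : ℝ) ^ j ≤ (B : ℝ) ^ 2 / 4 ∧ (B : ℝ) ^ 2 / 8 ≤ 2 ^ j := by
  have h9 : 9 ≤ B ^ 2 := by nlinarith
  refine ⟨Nat.log 2 (B ^ 2 / 4), Nat.log_pos one_lt_two (by omega), ?_, ?_⟩
  · have h1 := Nat.pow_log_le_self 2 (x := B ^ 2 / 4) (by omega)
    have h2 : 4 * 2 ^ Nat.log 2 (B ^ 2 / 4) ≤ B ^ 2 := by omega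
    have h3 : (4 : ℝ) * 2 ^ Nat.log 2 (B ^ 2 / 4) ≤ (B : ℝ) ^ 2 := by exact_mod_cast h2
    linarith
  · have h1 := Nat.lt_pow_succ_log_self one_lt_two (B ^ 2 / 4)
    rw [pow_succ (2 : ℕ)] at h1
    have h2 : B ^ 2 ≤ 8 * 2 ^ Nat.log 2 (B ^ 2 / 4) := by omega
    have h3 : (B : ℝ) ^ 2 ≤ 8 * 2 ^ Nat.log 2 (B ^ 2 / 4) := by exact_mod_cast h2
    linarith

theorem log_three_div_le {ε δ γ : ℝ} (hε : 0 < ε) (hε1 : ε ≤ 1) (hδ : 0 < δ) (hδ1 : δ < 1)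
    (hγ : 0 < γ) (hγ2 : γ < 1 / 2) : Real.log (3 / δ) ≤ 2 * Real.log (1 / (ε * γ * δ)) := by
  have h : Real.log (2 / δ) ≤ Real.log (1 / (ε * γ * δ)) := by
    refine Real.log_le_log (by positivity) ?_
    rw [div_le_div_iff₀ hδ (by positivity)]
    nlinarith [mul_le_mul hε1 hγ2.le hγ.le zero_le_one]
  have h3 : Real.log (3 / δ) ≤ 2 * Real.log (2 / δ) := by
    rw [← Real.log_rpow (by positivity)]
    refine Real.log_le_log (by positivity) ?_
    norm_cast
    rw [div_pow, div_le_div_iff₀ hδ (by positivity)]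
    nlinarith
  linarith

theorem exp_neg_le_third {δ x : ℝ} (hδ : 0 < δ) (h : Real.log (3 / δ) ≤ x) :
    Real.exp (-x) ≤ δ / 3 := by
  have h1 := Real.exp_le_exp.2 (neg_le_neg h)
  rwa [Real.exp_neg (Real.log (3 / δ)), Real.exp_log (by positivity), inv_div] at h1

theorem half_le_log {a : ℝ} (ha : 2 ≤ a) : 1 / 2 ≤ Real.log a := by
  have h := Real.log_le_log two_pos ha
  linarith [Real.log_two_gt_d9]

/-- If the time scale `B ^ 2` does not reach the sample size `T`, all thresholds are of order
`L * l`. -/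
theorem threshold_le {C₁ C₂ δ a l T M B : ℝ} (hC₁ : 4 ≤ C₁) (hC₂ : 0 < C₂) (hδ : 0 < δ)
    (ha : 2 ≤ a) (hal : Real.log a ≤ l) (hδl : Real.log (1 / δ) ≤ l) (hT0 : 0 < T)
    (hT : T ≤ 2 * C₁ * a * l) (hM0 : 0 ≤ M) (hM : M ≤ 1 + 2 * Real.log T) (hB : 8 * C₁ * l ≤ B)
    (hBT : B ^ 2 / 4 ≤ T) :
    4 * (M * (C₂ * Real.log (T / δ))) ≤ 8 * C₂ * (4 * C₁ + 3) ^ 2 * (Real.log a * l) := by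
  have hL := half_le_log ha
  have hl : 0 < l := by linarith
  -- From `(8 * C₁ * l) ^ 2 ≤ B ^ 2 ≤ 4 * T ≤ 8 * C₁ * a * l`. Then `T` is at most quadratic in `a`,
  -- so `log T` is of order `log a`, without `δ`; this avoids a second factor `log (1 / δ)`.
  have hla : l ≤ a := by
    have h1 : (8 * C₁ * l) ^ 2 ≤ B ^ 2 := pow_le_pow_left₀ (by positivity) hB 2
    have h2 : (8 * C₁ * l) * (8 * C₁ * l) ≤ (8 * C₁ * l) * a := by nlinarith
    have h3 := le_of_mul_le_mul_left h2 (by positivity)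
    nlinarith
  have hT2 : T ≤ (2 * C₁) * a ^ 2 := by
    nlinarith [mul_le_mul_of_nonneg_left hla (show 0 ≤ 2 * C₁ * a by positivity)]
  have hlogT : Real.log T ≤ (4 * C₁ + 2) * Real.log a := by
    have h1 := Real.log_le_log hT0 hT2
    rw [Real.log_mul (by positivity) (by positivity), Real.log_pow] at h1
    have h2 := Real.log_le_sub_one_of_pos (show 0 < 2 * C₁ by positivity)
    push_cast at h1
    nlinarith
  have hM' : M ≤ (8 * C₁ + 6) * Real.log a := by nlinarith
  have hTδ : Real.log (T / δ) ≤ (4 * C₁ + 3) * l := by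
    rw [div_eq_mul_one_div, Real.log_mul hT0.ne' (by positivity)]
    nlinarith
  calc 4 * (M * (C₂ * Real.log (T / δ))) ≤ 4 * (M * (C₂ * ((4 * C₁ + 3) * l))) := by gcongr
    _ ≤ 4 * ((8 * C₁ + 6) * Real.log a * (C₂ * ((4 * C₁ + 3) * l))) := by gcongr
    _ = 8 * C₂ * (4 * C₁ + 3) ^ 2 * (Real.log a * l) := by ring

theorem sampleSize_twoPoint (p : Icc (0 : ℝ) 1) {γ : ℝ} (hγ : 0 < γ) (C₁ ε δ : ℝ) :
    sampleSize (twoPointProblem p).regressors γ C₁ ε δ =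
      ⌈C₁ * (1 / (ε * γ)) * Real.log (1 / (ε * γ * δ))⌉₊ := by
  simp [sampleSize, disagreementSup_twoPoint p hγ, pseudoDim_twoPoint]

/-- Performance of the epoch-based algorithm on the two-point problem whose learnable point has
mass `1 / (2 B)`. -/
theorem epochAlgorithm_twoPoint {C₁ C₂ ε δ γ : ℝ} {B : ℕ} (hC₁ : 4 ≤ C₁) (hC₂ : 1 ≤ C₂)
    (hε : 0 < ε) (hε1 : ε ≤ 1) (hδ : 0 < δ) (hδ1 : δ < 1) (hγ : 0 < γ) (hγ2 : γ < 1 / 2)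
    (hB1 : 128 * Real.log (1 / (ε * γ * δ)) ≤ B) (hB2 : 8 * C₁ * Real.log (1 / (ε * γ * δ)) ≤ B)
    (hB3 : 512 * C₂ * (4 * C₁ + 3) ^ 2 *
      (Real.log (1 / (ε * γ)) * Real.log (1 / (ε * γ * δ))) ≤ B)
    (p : Icc (0 : ℝ) 1) (hp : (p : ℝ) = 1 / (2 * B)) (y : Bool)
    {oracle : List (Bool × Bool) → Bool → ℝ}
    (hor : IsRegressionOracle (twoPointProblem p).regressors oracle) :
    (twoPointProblem p).dataLaw (labelParam p y) {z | ¬ (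
        labelCount (twoPointProblem p).regressors oracle γ C₁ C₂ ε δ z ≤ B ∧
        (twoPointProblem p).randomizedExcess (labelParam p y)
          (returned (twoPointProblem p).regressors oracle γ C₁ C₂ ε δ z) ≤ ε)}
      ≤ ENNReal.ofReal δ := by
  set l := Real.log (1 / (ε * γ * δ)) with hl
  set a := 1 / (ε * γ) with ha
  set F := (twoPointProblem p).regressors with hF
  have hεγ : ε * γ ≤ 1 / 2 := by nlinarith
  have ha2 : 2 ≤ a := by
    rw [ha, le_div_iff₀ (by positivity)]
    linarith
  have hlsplit : l = Real.log a + Real.log (1 / δ) := by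
    rw [← Real.log_mul (by positivity) (by positivity), hl, ha]
    congr 1
    field_simp
  have hlogδ : 0 ≤ Real.log (1 / δ) := Real.log_nonneg (by rw [le_div_iff₀ hδ]; linarith)
  have hL := half_le_log ha2
  have hl0 : 0 ≤ l := by linarith
  have h3δ : Real.log (3 / δ) ≤ 2 * l := log_three_div_le hε hε1 hδ hδ1 hγ hγ2
  set T := sampleSize F γ C₁ ε δ with hT
  have hTeq : T = ⌈C₁ * a * l⌉₊ := sampleSize_twoPoint p hγ C₁ ε δ
  have hal : 1 ≤ a * l := by nlinarith
  have hT1 : C₁ * a * l ≤ T := by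
    rw [hTeq]
    exact Nat.le_ceil _
  have hT2 : (T : ℝ) ≤ 2 * C₁ * a * l := by
    have := (Nat.ceil_lt_add_one (show 0 ≤ C₁ * a * l by nlinarith)).le
    rw [← hTeq] at this
    nlinarith
  have hT4 : (4 : ℝ) ≤ T := by nlinarith
  have hT4' : 4 ≤ T := by exact_mod_cast hT4
  set M := epochs F γ C₁ ε δ with hM
  have hMlt : 2 ^ (M - 1) < T := Nat.pow_pred_clog_lt_self one_lt_two (by omega)
  have hTle : T ≤ 2 ^ M := Nat.le_pow_clog one_lt_two T
  have hM2 : 2 ≤ M := by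
    by_contra h
    have : 2 ^ M ≤ 2 ^ 1 := Nat.pow_le_pow_right two_pos (by omega)
    omega
  have hMlog : (M : ℝ) ≤ 1 + 2 * Real.log T := by
    have h1 : Real.log ((2 : ℝ) ^ (M - 1)) ≤ Real.log T :=
      Real.log_le_log (by positivity) (by exact_mod_cast hMlt.le)
    rw [Real.log_pow, Nat.cast_sub (by omega)] at h1
    push_cast at h1
    have h2 : (2 : ℝ) ≤ M := by exact_mod_cast hM2
    nlinarith [Real.log_two_gt_d9]
  set β := threshold F γ C₁ C₂ ε δ with hβdef
  have hβ : ∀ m, β m = ((M : ℝ) - m + 1) * (C₂ * Real.log (T / δ)) := by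
    intro m
    simp only [hβdef, threshold, hF, pseudoDim_twoPoint, ENat.toNat_one, Nat.cast_one, mul_one]
    rfl
  have hlogT : 0 ≤ C₂ * Real.log (T / δ) := by
    refine mul_nonneg (by linarith) (Real.log_nonneg ?_)
    rw [le_div_iff₀ hδ]
    linarith
  have hβ0 : ∀ m ≤ M, 0 ≤ β m := by
    intro m hm
    rw [hβ]
    have : (m : ℝ) ≤ M := by exact_mod_cast hm
    exact mul_nonneg (by linarith) hlogT
  have hanti : Antitone β := by
    intro m n hmn
    rw [hβ, hβ]
    have : (m : ℝ) ≤ n := by exact_mod_cast hmn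
    exact mul_le_mul_of_nonneg_right (by linarith) hlogT
  have hB0 : (64 : ℝ) ≤ B := by linarith
  have hB3' : 3 ≤ B := by
    have : (3 : ℝ) ≤ B := by linarith
    exact_mod_cast this
  obtain ⟨j, hj, hj1, hj2⟩ := exists_time_scale hB3'
  have hpB : (p : ℝ) * B = 1 / 2 := by
    rw [hp]
    field_simp
  have hp0 : 0 ≤ (p : ℝ) := p.2.1
  -- `K` dominates four times each threshold in the case `T ≥ B ^ 2 / 4`, and `K ≤ B / 64` by `hB3`,
  -- where `512 = 64 * 8`.
  set K := 8 * C₂ * (4 * C₁ + 3) ^ 2 * (Real.log a * l) with hK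
  have hpj1 : (p : ℝ) * 2 ^ j ≤ B / 8 := by
    calc (p : ℝ) * 2 ^ j ≤ p * ((B : ℝ) ^ 2 / 4) := by gcongr
      _ = (p * B) * B / 4 := by ring
      _ = B / 8 := by rw [hpB]; ring
  have hpj2 : (B : ℝ) / 16 ≤ p * 2 ^ j := by
    calc (B : ℝ) / 16 = (p * B) * B / 8 := by rw [hpB]; ring
      _ = p * ((B : ℝ) ^ 2 / 8) := by ring
      _ ≤ p * 2 ^ j := by gcongr
  let D := (twoPointProblem p).dataLaw (labelParam p y)
  -- The exponent is at most `B / 4 - B`, below `-2 * l`.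
  have hmany : D {z | (B : ℝ) ≤ visits z (2 ^ j)} ≤ ENNReal.ofReal (δ / 3) := by
    refine (measure_le_visits p y (2 ^ j) B).trans (ENNReal.ofReal_le_ofReal ?_)
    refine le_trans (Real.exp_le_exp.2 ?_) (exp_neg_le_third hδ h3δ)
    push_cast
    linarith
  -- The exponent is at most `B / 64 - B / 32 = -B / 64`, and the factor `128` in `hB1` makes this
  -- at most `-2 * l`.
  have hfew : D {z | (visits z (2 ^ j) : ℝ) ≤ K} ≤ ENNReal.ofReal (δ / 3) := by
    refine (measure_visits_le p y (2 ^ j) K).trans (ENNReal.ofReal_le_ofReal ?_)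
    refine le_trans (Real.exp_le_exp.2 ?_) (exp_neg_le_third hδ h3δ)
    push_cast
    linarith
  -- If `ε < p`, the expected number of visits `p * 2 ^ (M - 1)` is at least `ε * T / 2 ≥ C₁ * (ε *
  -- a) * l / 2 ≥ 4 * l`, because `ε * a = 1 / γ ≥ 2`.
  have hnone : D {z | ε < p ∧ visits z (2 ^ (M - 1)) = 0} ≤ ENNReal.ofReal (δ / 3) := by
    by_cases hεp : ε < p
    · refine (measure_mono (fun z hz => ?_)).trans ((measure_visits_le p y (2 ^ (M - 1)) 0).trans
        (ENNReal.ofReal_le_ofReal (le_trans (Real.exp_le_exp.2 ?_) (exp_neg_le_third hδ h3δ))))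
      · have h0 : visits z (2 ^ (M - 1)) = 0 := hz.2
        simp [h0]
      · have h1 : (T : ℝ) ≤ 2 * 2 ^ (M - 1) := by
          rw [← pow_succ', Nat.sub_add_cancel (by omega)]
          exact_mod_cast hTle
        have h2 : ε * a * γ = 1 := by
          rw [ha]
          field_simp
        have h3 : 2 ≤ ε * a := by
          by_contra hlt
          nlinarith [mul_pos hε (show 0 < a by linarith)]
        have h4 : 4 * 2 * l ≤ C₁ * (ε * a) * l := by gcongr
        have h5 : ε * (C₁ * a * l) ≤ ε * (2 * 2 ^ (M - 1)) :=
          mul_le_mul_of_nonneg_left (hT1.trans h1) hε.le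
        have h6 : ε * (2 * 2 ^ (M - 1)) ≤ p * (2 * 2 ^ (M - 1)) := by gcongr
        push_cast
        linarith
    · simp [hεp]
  have hsub : {z | ¬ (labelCount F oracle γ C₁ C₂ ε δ z ≤ B ∧
        (twoPointProblem p).randomizedExcess (labelParam p y)
          (returned F oracle γ C₁ C₂ ε δ z) ≤ ε)} ⊆
      {z | ¬ ∀ t, (z t).1 = true → (z t).2 = y} ∪ ({z | (B : ℝ) ≤ visits z (2 ^ j)} ∪
        ({z | (visits z (2 ^ j) : ℝ) ≤ K} ∪ {z | ε < p ∧ visits z (2 ^ (M - 1)) = 0})) := by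
    intro z hz
    by_contra hgood
    simp only [mem_union, mem_ofPred_eq, not_or, not_not, not_le, not_and] at hgood
    obtain ⟨hlab, hmax, hmin, hvis⟩ := hgood
    refine hz ⟨?_, ?_⟩
    · refine length_queried_le hor hγ2 hlab hj (fun m hm => hβ0 m (hm.trans (Nat.sub_le M 1)))
        hanti (by exact_mod_cast hmax.le) ?_ (M - 1) le_rfl
      -- If the run goes past epoch `j`, then `B ^ 2 / 4 ≤ 2 * 2 ^ j ≤ T`, which is the regime of
      -- `threshold_le`.
      refine or_iff_not_imp_left.2 fun hMj m hm => lt_of_le_of_lt ?_ hmin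
      have hjT : (2 : ℝ) * 2 ^ j ≤ T := by
        have h1 : 2 ^ (j + 1) ≤ 2 ^ (M - 1) := Nat.pow_le_pow_right two_pos (by omega)
        rw [pow_succ'] at h1
        exact_mod_cast h1.trans hMlt.le
      have h2 := threshold_le (M := M) hC₁ (by linarith : 0 < C₂) hδ ha2 (by linarith : _ ≤ l)
        (by linarith) (by linarith : (0 : ℝ) < T) hT2 (Nat.cast_nonneg _) hMlog hB2 (by linarith)
      refine le_trans ?_ h2
      rw [hβ]
      have h3 : (1 : ℝ) ≤ m := by exact_mod_cast hm
      have h4 : ((M : ℝ) - m + 1) * (C₂ * Real.log (T / δ)) ≤ M * (C₂ * Real.log (T / δ)) :=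
        mul_le_mul_of_nonneg_right (by linarith only [h3]) hlogT
      exact mul_le_mul_of_nonneg_left h4 zero_le_four
    · by_cases hεp : ε < p
      · have hne : (finalSample F oracle γ C₁ C₂ ε δ z).length ≠ 0 := by
          refine length_queried_ne_zero hor hγ2 hβ0 (M - 1) (Nat.sub_le M 1) ?_
          rw [epochEnd, if_neg (by omega)]
          exact hvis hεp
        rw [randomizedExcess_twoPoint_of_eq p (y := y)]
        · exact hε.le
        · rw [returned, show finalSample F oracle γ C₁ C₂ ε δ z =
              List.replicate (finalSample F oracle γ C₁ C₂ ε δ z).length (true, y) from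
            queried_eq_replicate hlab _]
          exact classifier_true_of_pos hor hne (hβ0 M le_rfl) hγ2
      · exact (randomizedExcess_twoPoint_le p y _).trans (not_lt.1 hεp)
  calc D _ ≤ D _ := measure_mono hsub
    _ ≤ 0 + (ENNReal.ofReal (δ / 3) + (ENNReal.ofReal (δ / 3) + ENNReal.ofReal (δ / 3))) := by
        refine (measure_union_le _ _).trans (add_le_add (measure_wrong_label p y).le ?_)
        refine (measure_union_le _ _).trans (add_le_add hmany ?_)
        exact (measure_union_le _ _).trans (add_le_add hfew hnone)
    _ = ENNReal.ofReal δ := by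
        rw [zero_add, ← ENNReal.ofReal_add (by positivity) (by positivity),
          ← ENNReal.ofReal_add (by positivity) (by positivity)]
        congr 1
        ring

/-- The three bounds used need only `log (1 / (ε * γ)) * log (1 / (ε * γ * δ))`; the factor `1 / γ ^
2 ≥ 4` and one logarithm, at least `1/2`, are discarded. -/
theorem budget_bounds {C₁ C₂ ε δ γ B : ℝ} (hC₁ : 4 ≤ C₁) (hC₂ : 1 ≤ C₂)
    (hε : 0 < ε) (hε1 : ε ≤ 1) (hδ : 0 < δ) (hδ1 : δ < 1) (hγ : 0 < γ) (hγ2 : γ < 1 / 2)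
    (hB : 512 * C₂ * (4 * C₁ + 3) ^ 2 * (1 / γ ^ 2) * Real.log (1 / (ε * γ)) ^ 2 *
      Real.log (1 / (ε * γ * δ)) ≤ B) :
    0 < B ∧ 128 * Real.log (1 / (ε * γ * δ)) ≤ B ∧ 8 * C₁ * Real.log (1 / (ε * γ * δ)) ≤ B ∧
      512 * C₂ * (4 * C₁ + 3) ^ 2 *
        (Real.log (1 / (ε * γ)) * Real.log (1 / (ε * γ * δ))) ≤ B := by
  have hL : 1 / 2 ≤ Real.log (1 / (ε * γ)) := by
    refine half_le_log ?_
    rw [le_div_iff₀ (by positivity)]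
    nlinarith
  have hl : Real.log (1 / (ε * γ)) ≤ Real.log (1 / (ε * γ * δ)) := by
    refine Real.log_le_log (by positivity) ?_
    refine one_div_le_one_div_of_le (by positivity) ?_
    exact mul_le_of_le_one_right (by positivity) hδ1.le
  have hg : 4 ≤ 1 / γ ^ 2 := by
    rw [le_div_iff₀ (by positivity)]
    nlinarith
  set L := Real.log (1 / (ε * γ))
  set l := Real.log (1 / (ε * γ * δ))
  have hl0 : 0 < l := by linarith
  have hA : 256 * C₁ ≤ 512 * C₂ * (4 * C₁ + 3) ^ 2 := by nlinarith
  set A := 512 * C₂ * (4 * C₁ + 3) ^ 2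
  have hA0 : 0 < A := by linarith
  have hLl : A * (L * l) ≤ B := by
    refine le_trans ?_ hB
    calc A * (L * l) ≤ A * ((4 * L) * L * l) := by
          gcongr
          nlinarith
      _ = A * 4 * L ^ 2 * l := by ring
      _ ≤ A * (1 / γ ^ 2) * L ^ 2 * l := by gcongr
  have hAl : A / 2 * l ≤ B := by
    refine le_trans ?_ hLl
    calc A / 2 * l = A * (1 / 2 * l) := by ring
      _ ≤ A * (L * l) := by gcongr
  have h1 : 128 * C₁ * l ≤ B := le_trans (by gcongr; linarith) hAl
  have hC₁l : 4 * l ≤ C₁ * l := by gcongr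
  exact ⟨by linarith, by linarith, by linarith, hLl⟩

end ActiveLearning

/-! ### Choice of the constants and of `p`. -/

theorem mainTheorem6 :
    ∃ c > (0 : ℝ), ∃ C₂₀ > (0 : ℝ), ∀ C₂ ≥ C₂₀, ∃ C₁₀ > (0 : ℝ), ∀ C₁ ≥ C₁₀, ∃ C₃ > (0 : ℝ),
    ∀ ε δ γ : ℝ, 0 < ε → ε ≤ 1 → 0 < δ → δ < 1 → 0 < γ → γ < 1 / 2 →
    ∀ B : ℕ,
      C₃ * (1 / γ ^ 2) * Real.log (1 / (ε * γ)) ^ 2 * Real.log (1 / (ε * γ * δ)) ≤ (B : ℝ) →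
    ∃ (X : Type) (_ : MeasurableSpace X) (P : ActiveLearning.LinearProblem X),
      -- the noise conditions, for every possible true regression function
      (∀ w ∈ P.prior.support,
        (∀ ζ τ : ℝ, 0 ≤ ζ → ζ < τ → τ < 1 / 2 → P.NoiseSeekingMassart w ζ τ) ∧
        (∀ ζ β : ℝ, 0 ≤ ζ → ζ < 1 / 2 → 0 ≤ β →
          P.NoiseSeekingTsybakov w ζ β ((2 : ℝ) ^ β))) ∧
      -- (1) every uncertainty-based learner with budget `B` has expected excess error `Ω(1 / B)`
      (∀ L : ActiveLearning.ActiveLearner X, L.UncertaintyBased P B →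
        c / (B : ℝ) ≤ L.expectedExcess P B) ∧
      -- (2) the epoch-based algorithm stays within the budget and has excess error at most `ε`
      ActiveLearning.pseudoDim P.regressors ≠ ⊤ ∧
      ActiveLearning.disagreementSup P.regressors γ ≠ ⊤ ∧
      (∃ oracle, ActiveLearning.EpochAlgorithm.IsRegressionOracle P.regressors oracle) ∧
      (∀ oracle, ActiveLearning.EpochAlgorithm.IsRegressionOracle P.regressors oracle →
        ∀ w ∈ P.prior.support,
        P.dataLaw w {z | ¬ (
          ActiveLearning.EpochAlgorithm.labelCount P.regressors oracle γ C₁ C₂ ε δ z ≤ B ∧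
          P.randomizedExcess w
            (ActiveLearning.EpochAlgorithm.returned P.regressors oracle γ C₁ C₂ ε δ z) ≤ ε)}
        ≤ ENNReal.ofReal δ) := by

  refine ⟨1 / 8, by norm_num, 1, one_pos, fun C₂ hC₂ => ⟨4, by norm_num, fun C₁ hC₁ =>
    ⟨512 * C₂ * (4 * C₁ + 3) ^ 2, mul_pos (by linarith) (pow_pos (by linarith) 2), ?_⟩⟩⟩
  intro ε δ γ hε hε1 hδ hδ1 hγ hγ2 B hB
  obtain ⟨hB0, hB1, hB2, hB3⟩ :=
    ActiveLearning.budget_bounds hC₁ hC₂ hε hε1 hδ hδ1 hγ hγ2 hB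
  have hB0' : (1 : ℝ) ≤ B := by
    have : 0 < B := by exact_mod_cast hB0
    exact_mod_cast this
  let p : Icc (0 : ℝ) 1 := ⟨1 / (2 * B), by positivity, by
    rw [div_le_one (by positivity)]
    linarith⟩
  refine ⟨Bool, inferInstance, ActiveLearning.twoPointProblem p, ?_, ?_, ?_, ?_,
    ActiveLearning.exists_isRegressionOracle p, ?_⟩
  · intro w hw
    obtain ⟨y, rfl⟩ := ActiveLearning.mem_support_prior p hw
    exact ⟨fun ζ τ hζ h hτ => ActiveLearning.massart_twoPoint p y hζ h hτ,
      fun ζ β hζ h hβ => ActiveLearning.tsybakov_twoPoint p y hζ h hβ⟩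
  · intro L hL
    refine le_trans ?_ (ActiveLearning.expectedExcess_lower_bound p hL)
    have hpB : (p : ℝ) = 1 / (2 * B) := rfl
    have hp1 : (p : ℝ) ≤ 1 := p.2.2
    -- Bernoulli's inequality gives `(1 - p) ^ B ≥ 1 - B * p = 1/2`, whence the constant `1/8 = 1/2
    -- * 1/2 * 1/2`.
    have hbern := one_add_mul_le_pow (a := -(p : ℝ)) (by linarith) B
    have hhalf : (B : ℝ) * -(p : ℝ) = -(1 / 2) := by
      rw [hpB]
      field_simp
    rw [hhalf, ← sub_eq_add_neg, ← sub_eq_add_neg] at hbern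
    calc 1 / 8 / (B : ℝ) = p * (1 - 1 / 2) / 2 := by
          rw [hpB]
          field_simp
          norm_num
      _ ≤ p * (1 - p) ^ B / 2 := by
          have := p.2.1
          gcongr
  · rw [ActiveLearning.pseudoDim_twoPoint]
    exact ENat.one_ne_top
  · rw [ActiveLearning.disagreementSup_twoPoint p hγ]
    exact ENNReal.one_ne_top
  · intro oracle hor w hw
    obtain ⟨y, rfl⟩ := ActiveLearning.mem_support_prior p hw
    exact ActiveLearning.epochAlgorithm_twoPoint hC₁ hC₂ hε hε1 hδ hδ1 hγ hγ2 hB1 hB2 hB3 p rfl y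
      hor
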